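/- **Conventions.** Manifolds, submanifolds (possibly immersed) and metrics are smooth, and manifolds have no boundary. For a Riemannian metric $g$ with curvature tensor $R(X,Y,Z,W)=g(\nabla_X\nabla_YZ-\nabla_Y\nabla_XZ-\nabla_{[X,Y]}Z,\,W)$ put $\mathrm{curv}(X,W)=R(X,W,W,X)$. A *zero plane* of $g$ is a plane $\mathrm{span}\{X,W\}\subset T_pM$ ($X,W$ linearly independent) with $\mathrm{curv}(X,W)=0$. The metric $g$ is *nonnegatively curved at* $p$ if $\mathrm{curv}(X,W)\ge 0$ for all $X,W\in T_pM$. We say that (the zero planes of) $g$ satisfy the *quadratic nondegeneracy condition* if there is a compact set $\mathcal Q$ of quadruples $(X,W,Z,V)$ of tangent vectors with a common foot point, such that 1. for each $(X,W,Z,V)\in\mathcal Q$, $\mathrm{span}\{X,W\}$ is a zero plane, and the total quadratic term of the polynomial $\mathrm{curv}(X+\sigma Z,W+\tau V)$ satisfies $$\sigma^2\,\mathrm{curv}(Z,W)+2\sigma\tau\,\bigl(R(X,W,V,Z)+R(X,V,W,Z)\bigr)+\tau^2\,\mathrm{curv}(X,V)>0\quad\text{for all }(\sigma,\tau)\in S^1;$$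 2. for every $\varepsilon>0$, the zero planes together with the planes $\mathrm{span}\{X+\sigma Z,W+\tau V\}$, $(X,W,Z,V)\in\mathcal Q$, $\sigma,\tau\in[0,\varepsilon]$, contain a neighbourhood of the set of zero planes within the set of all tangent planes at those points of $M$ that carry a zero plane. **Theorem.** Let $(M,g)$ be a compact, nonnegatively curved Riemannian manifold, and let $\mathcal S$ be a family of totally geodesic flat submanifolds of $(M,g)$ of dimension at least two such that every zero plane of $g$ is contained in a tangent space of a member of $\mathcal S$. Assume that $g$ satisfies the quadratic nondegeneracy condition. Then there is a neighbourhood $\mathcal U$ of $g$ in the $C^2$ topology on the set of Riemannian metrics of $M$ with the following property. Let $\tilde g\in\mathcal U$ be a metric such that, for every $S\in\mathcal S$ and every point $p$ of $S$, * $g(X,\cdot)=\tilde g(X,\cdot)$ on $T_pM$ for all $X\in T_pS$, and * for all $X,Y\in T_pS$, the functions $g(X,Y)$ and $\tilde g(X,Y)$ have the same derivative at $p$ in every direction of $T_pM$, where $X$ and $Y$ are extended to smooth vector fields near $p$ (by the first condition the choice of the extensions does not matter). Then at every point of the union of the members of $\mathcal S$, $\tilde g$ is nonnegatively curved and has exactly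 the same zero planes as $g$. -/

import Mathlib

open Set
open scoped Manifold ContDiff Topology

noncomputable section

/-! ### Riemannian geometry in coordinates -/

namespace CoordGeometry

variable {E : Type*} [NormedAddCommGroup E] [NormedSpace ℝ E]

/-- Christoffel symbols of the first kind of the metric coefficients `G` at `z`, as a linear form in
the last slot: `w ↦ (D_u G (v, w) + D_v G (u, w) - D_w G (u, v)) / 2`. -/
def christoffelFirst (G : E → E →L[ℝ] E →L[ℝ] ℝ) (z u v : E) : E →L[ℝ] ℝ :=
  (1 / 2 : ℝ) • (fderiv ℝ G z u v + fderiv ℝ G z v u - ((fderiv ℝ G z).flip u).flip v)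

/-- The Christoffel map `Γ_z(u, v) = ∇_u v` (constant coordinate fields `u`, `v`) of the Levi-Civita
connection: the vector with `G_z (Γ_z(u, v), w) = christoffelFirst G z u v w` for all `w`. -/
def christoffel (G : E → E →L[ℝ] E →L[ℝ] ℝ) (z u v : E) : E :=
  (G z).inverse (christoffelFirst G z u v)

/-- `R(u, v) w = ∇_u ∇_v w - ∇_v ∇_u w` for constant coordinate fields `u`, `v`, `w`. -/
def curvatureOp (G : E → E →L[ℝ] E →L[ℝ] ℝ) (z u v w : E) : E :=
  fderiv ℝ (fun y => christoffel G y v w) z u - fderiv ℝ (fun y => christoffel G y u w) z v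
    + christoffel G z u (christoffel G z v w) - christoffel G z v (christoffel G z u w)

/-- The curvature tensor `R(u, v, w, x) = G (R(u, v) w, x)`. -/
def curvatureTensor (G : E → E →L[ℝ] E →L[ℝ] ℝ) (z u v w x : E) : ℝ :=
  G z (curvatureOp G z u v w) x

end CoordGeometry

/-! ### Bilinear forms and curvature on manifolds -/

/-- The pullback `(u, v) ↦ B (L u, L v)` of a bilinear form. -/
def pullbackForm {V V' : Type*} [AddCommGroup V] [Module ℝ V] [TopologicalSpace V]
    [IsTopologicalAddGroup V] [ContinuousSMul ℝ V]
    [AddCommGroup V'] [Module ℝ V'] [TopologicalSpace V']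
    [IsTopologicalAddGroup V'] [ContinuousSMul ℝ V']
    (B : V →L[ℝ] V →L[ℝ] ℝ) (L : V' →L[ℝ] V) : V' →L[ℝ] V' →L[ℝ] ℝ :=
  (ContinuousLinearMap.precomp ℝ L).comp (B.comp L)

theorem pullbackForm_apply {V V' : Type*} [AddCommGroup V] [Module ℝ V] [TopologicalSpace V]
    [IsTopologicalAddGroup V] [ContinuousSMul ℝ V]
    [AddCommGroup V'] [Module ℝ V'] [TopologicalSpace V']
    [IsTopologicalAddGroup V'] [ContinuousSMul ℝ V']
    (B : V →L[ℝ] V →L[ℝ] ℝ) (L : V' →L[ℝ] V) (u v : V') :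
    pullbackForm B L u v = B (L u) (L v) := rfl

section Manifold

variable {E : Type*} [NormedAddCommGroup E] [NormedSpace ℝ E]
  {M : Type*} [TopologicalSpace M] [ChartedSpace E M]

/-- The coefficients, in the preferred chart at `c`, of a field `g` of bilinear forms on `M`; they
are meaningful on the target of that chart. -/
def metricCoeff (g : ∀ x : M, TangentSpace 𝓘(ℝ, E) x →L[ℝ] TangentSpace 𝓘(ℝ, E) x →L[ℝ] ℝ)
    (c : M) (z : E) : E →L[ℝ] E →L[ℝ] ℝ :=
  pullbackForm (g ((extChartAt 𝓘(ℝ, E) c).symm z))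
    (mfderiv 𝓘(ℝ, E) 𝓘(ℝ, E) (extChartAt 𝓘(ℝ, E) c).symm z)

/-- The coordinate expression, in the preferred chart at `p`, of a tangent vector at `p`. -/
def vecCoord (p : M) (X : TangentSpace 𝓘(ℝ, E) p) : E :=
  mfderiv 𝓘(ℝ, E) 𝓘(ℝ, E) (extChartAt 𝓘(ℝ, E) p) p X

/-- The Riemann curvature tensor `R(X, Y, Z, W) = g (R(X, Y) Z, W)` at `p`. -/
def riemann (g : ∀ x : M, TangentSpace 𝓘(ℝ, E) x →L[ℝ] TangentSpace 𝓘(ℝ, E) x →L[ℝ] ℝ)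
    (p : M) (X Y Z W : TangentSpace 𝓘(ℝ, E) p) : ℝ :=
  CoordGeometry.curvatureTensor (metricCoeff g p) (extChartAt 𝓘(ℝ, E) p p)
    (vecCoord p X) (vecCoord p Y) (vecCoord p Z) (vecCoord p W)

/-- `curv(X, W) = R(X, W, W, X)`: the sectional curvature times the squared area. -/
def curv (g : ∀ x : M, TangentSpace 𝓘(ℝ, E) x →L[ℝ] TangentSpace 𝓘(ℝ, E) x →L[ℝ] ℝ)
    (p : M) (X W : TangentSpace 𝓘(ℝ, E) p) : ℝ :=
  riemann g p X W W X

/-- `X`, `W` span a plane of zero sectional curvature. -/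
def IsZeroPlane (g : ∀ x : M, TangentSpace 𝓘(ℝ, E) x →L[ℝ] TangentSpace 𝓘(ℝ, E) x →L[ℝ] ℝ)
    (p : M) (X W : TangentSpace 𝓘(ℝ, E) p) : Prop :=
  LinearIndependent ℝ ![X, W] ∧ curv g p X W = 0

/-- All sectional curvatures at `p` are nonnegative. -/
def NonnegCurvedAt (g : ∀ x : M, TangentSpace 𝓘(ℝ, E) x →L[ℝ] TangentSpace 𝓘(ℝ, E) x →L[ℝ] ℝ)
    (p : M) : Prop :=
  ∀ X W : TangentSpace 𝓘(ℝ, E) p, 0 ≤ curv g p X W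

/-- The quadratic form
`σ² curv(Z, W) + 2στ (R(X, W, V, Z) + R(X, V, W, Z)) + τ² curv(X, V)`,
i.e. the total quadratic term of `curv(X + σ Z, W + τ V)`. -/
def quadraticTerm (g : ∀ x : M, TangentSpace 𝓘(ℝ, E) x →L[ℝ] TangentSpace 𝓘(ℝ, E) x →L[ℝ] ℝ)
    (p : M) (X W Z V : TangentSpace 𝓘(ℝ, E) p) (σ τ : ℝ) : ℝ :=
  σ ^ 2 * curv g p Z W + 2 * σ * τ * (riemann g p X W V Z + riemann g p X V W Z)
    + τ ^ 2 * curv g p X V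

/-- The quadratic nondegeneracy condition. Near the zero planes, and at the points that carry one,
all planes can be written as `span {X + σ Z, W + τ V}` with `span {X, W}` a zero plane, small
`σ, τ ≥ 0` and `(X, W, Z, V)` in a compact set `Q` of quadruples, such that for each quadruple in
`Q` the quadratic term of `curv(X + σ Z, W + τ V)` is positive for all `(σ, τ)` in the unit circle.
A neighbourhood of the set of zero planes is given by an open set `U` of pairs of vectors that
contains every basis of every zero plane. -/
def QuadraticallyNondegenerate
    (g : ∀ x : M, TangentSpace 𝓘(ℝ, E) x →L[ℝ] TangentSpace 𝓘(ℝ, E) x →L[ℝ] ℝ)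
    [IsManifold 𝓘(ℝ, E) ∞ M] : Prop :=
  ∃ Q : ∀ p : M, Set (TangentSpace 𝓘(ℝ, E) p × TangentSpace 𝓘(ℝ, E) p ×
      TangentSpace 𝓘(ℝ, E) p × TangentSpace 𝓘(ℝ, E) p),
    IsCompact {q : TangentBundle 𝓘(ℝ, E) M × TangentBundle 𝓘(ℝ, E) M ×
        TangentBundle 𝓘(ℝ, E) M × TangentBundle 𝓘(ℝ, E) M |
      ∃ (p : M) (X W Z V : TangentSpace 𝓘(ℝ, E) p),
        (X, W, Z, V) ∈ Q p ∧ q = (⟨p, X⟩, ⟨p, W⟩, ⟨p, Z⟩, ⟨p, V⟩)} ∧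
    (∀ (p : M) (X W Z V : TangentSpace 𝓘(ℝ, E) p), (X, W, Z, V) ∈ Q p →
      IsZeroPlane g p X W ∧
      ∀ σ τ : ℝ, σ ^ 2 + τ ^ 2 = 1 → 0 < quadraticTerm g p X W Z V σ τ) ∧
    (∀ ε : ℝ, 0 < ε →
      ∃ U : Set (TangentBundle 𝓘(ℝ, E) M × TangentBundle 𝓘(ℝ, E) M), IsOpen U ∧
        (∀ (p : M) (X W : TangentSpace 𝓘(ℝ, E) p), IsZeroPlane g p X W →
          ((⟨p, X⟩, ⟨p, W⟩) : TangentBundle 𝓘(ℝ, E) M × TangentBundle 𝓘(ℝ, E) M) ∈ U) ∧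
        (∀ (p : M) (A B : TangentSpace 𝓘(ℝ, E) p),
          (∃ X W : TangentSpace 𝓘(ℝ, E) p, IsZeroPlane g p X W) →
          LinearIndependent ℝ ![A, B] →
          ((⟨p, A⟩, ⟨p, B⟩) : TangentBundle 𝓘(ℝ, E) M × TangentBundle 𝓘(ℝ, E) M) ∈ U →
          IsZeroPlane g p A B ∨
          ∃ X W Z V : TangentSpace 𝓘(ℝ, E) p, (X, W, Z, V) ∈ Q p ∧
            ∃ σ ∈ Icc (0 : ℝ) ε, ∃ τ ∈ Icc (0 : ℝ) ε,
              Submodule.span ℝ {A, B} = Submodule.span ℝ {X + σ • Z, W + τ • V}))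

end Manifold

/-! ### Smooth metrics and the `C²` topology on them -/

/-- Smooth Riemannian metrics on `M`. -/
abbrev SmoothMetric (E : Type*) [NormedAddCommGroup E] [NormedSpace ℝ E]
    (M : Type*) [TopologicalSpace M] [ChartedSpace E M] [IsManifold 𝓘(ℝ, E) ∞ M] :=
  Bundle.ContMDiffRiemannianMetric 𝓘(ℝ, E) ∞ E (fun x : M => TangentSpace 𝓘(ℝ, E) x)

section C2

variable {E : Type*} [NormedAddCommGroup E] [NormedSpace ℝ E]
  {M : Type*} [TopologicalSpace M] [ChartedSpace E M] [IsManifold 𝓘(ℝ, E) ∞ M]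

/-- The metrics whose coefficients, in the chart at `c` and on `K`, differ from those of `g` by
less than `δ` together with their derivatives of order at most two. -/
def c2Ball (g : SmoothMetric E M) (c : M) (K : Set E) (δ : ℝ) : Set (SmoothMetric E M) :=
  {g' | ∀ z ∈ K, ∀ k : ℕ, k ≤ 2 →
    ‖iteratedFDeriv ℝ k (fun y => metricCoeff g'.inner c y - metricCoeff g.inner c y) z‖ < δ}

/-- The `C²` topology (uniform convergence of the coefficients and of their derivatives of order at
most two on compact subsets of charts). -/
@[reducible]
def c2Topology (E : Type*) [NormedAddCommGroup E] [NormedSpace ℝ E]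
    (M : Type*) [TopologicalSpace M] [ChartedSpace E M] [IsManifold 𝓘(ℝ, E) ∞ M] :
    TopologicalSpace (SmoothMetric E M) :=
  TopologicalSpace.generateFrom
    {B | ∃ (g : SmoothMetric E M) (c : M) (K : Set E) (δ : ℝ),
      IsCompact K ∧ K ⊆ (extChartAt 𝓘(ℝ, E) c).target ∧ 0 < δ ∧ B = c2Ball g c K δ}

end C2

/-! ### Submanifolds -/

/-- A smooth (immersed) submanifold of `M`. -/
structure ImmersedSubmanifold.{w, u, v} (E : Type u) [NormedAddCommGroup E] [NormedSpace ℝ E]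
    (M : Type v) [TopologicalSpace M] [ChartedSpace E M] where
  dim : ℕ
  carrier : Type w
  [topology : TopologicalSpace carrier]
  [charted : ChartedSpace (EuclideanSpace ℝ (Fin dim)) carrier]
  [smooth : IsManifold 𝓘(ℝ, EuclideanSpace ℝ (Fin dim)) ∞ carrier]
  toFun : carrier → M
  contMDiff : ContMDiff 𝓘(ℝ, EuclideanSpace ℝ (Fin dim)) 𝓘(ℝ, E) ∞ toFun
  immersion : ∀ y, Function.Injective
    (mfderiv 𝓘(ℝ, EuclideanSpace ℝ (Fin dim)) 𝓘(ℝ, E) toFun y)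

namespace ImmersedSubmanifold

variable {E : Type*} [NormedAddCommGroup E] [NormedSpace ℝ E]
  {M : Type*} [TopologicalSpace M] [ChartedSpace E M]

attribute [instance] topology charted smooth

/-- The tangent space of the submanifold at (the image of) `y`, inside the one of `M`. -/
def tangent (S : ImmersedSubmanifold E M) (y : S.carrier) :
    Submodule ℝ (TangentSpace 𝓘(ℝ, E) (S.toFun y)) :=
  LinearMap.range
    (mfderiv 𝓘(ℝ, EuclideanSpace ℝ (Fin S.dim)) 𝓘(ℝ, E) S.toFun y).toLinearMap

/-- The plane spanned by `X`, `W` at `p` is contained in a tangent space of the submanifold. -/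
def ContainsPlane (S : ImmersedSubmanifold E M) (p : M) (X W : TangentSpace 𝓘(ℝ, E) p) :
    Prop :=
  ∃ (y : S.carrier) (u v : TangentSpace 𝓘(ℝ, EuclideanSpace ℝ (Fin S.dim)) y),
    tangentMap 𝓘(ℝ, EuclideanSpace ℝ (Fin S.dim)) 𝓘(ℝ, E) S.toFun ⟨y, u⟩ = ⟨p, X⟩ ∧
    tangentMap 𝓘(ℝ, EuclideanSpace ℝ (Fin S.dim)) 𝓘(ℝ, E) S.toFun ⟨y, v⟩ = ⟨p, W⟩

/-- The inclusion in the preferred charts at `y` and at its image. -/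
def localExpr (S : ImmersedSubmanifold E M) (y : S.carrier) :
    EuclideanSpace ℝ (Fin S.dim) → E :=
  extChartAt 𝓘(ℝ, E) (S.toFun y) ∘ S.toFun ∘
    (extChartAt 𝓘(ℝ, EuclideanSpace ℝ (Fin S.dim)) y).symm

/-- The second fundamental form vanishes: `∇_u v`, which for coordinate fields `u`, `v` of the
submanifold is `D²F(u, v) + Γ(DF u, DF v)`, is always tangent to the submanifold. -/
def IsTotallyGeodesic (S : ImmersedSubmanifold E M)
    (g : ∀ x : M, TangentSpace 𝓘(ℝ, E) x →L[ℝ] TangentSpace 𝓘(ℝ, E) x →L[ℝ] ℝ) : Prop :=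
  ∀ (y : S.carrier) (u v : EuclideanSpace ℝ (Fin S.dim)),
    let F := S.localExpr y
    let z := extChartAt 𝓘(ℝ, EuclideanSpace ℝ (Fin S.dim)) y y
    fderiv ℝ (fderiv ℝ F) z u v
      + CoordGeometry.christoffel (metricCoeff g (S.toFun y))
          (extChartAt 𝓘(ℝ, E) (S.toFun y) (S.toFun y)) (fderiv ℝ F z u) (fderiv ℝ F z v)
      ∈ LinearMap.range (fderiv ℝ F z).toLinearMap

/-- The metric induced on the submanifold. -/
def inducedMetric (S : ImmersedSubmanifold E M)
    (g : ∀ x : M, TangentSpace 𝓘(ℝ, E) x →L[ℝ] TangentSpace 𝓘(ℝ, E) x →L[ℝ] ℝ)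
    (y : S.carrier) :
    TangentSpace 𝓘(ℝ, EuclideanSpace ℝ (Fin S.dim)) y →L[ℝ]
      TangentSpace 𝓘(ℝ, EuclideanSpace ℝ (Fin S.dim)) y →L[ℝ] ℝ :=
  pullbackForm (g (S.toFun y))
    (mfderiv 𝓘(ℝ, EuclideanSpace ℝ (Fin S.dim)) 𝓘(ℝ, E) S.toFun y)

/-- The curvature tensor of the induced metric vanishes. -/
def IsFlat (S : ImmersedSubmanifold E M)
    (g : ∀ x : M, TangentSpace 𝓘(ℝ, E) x →L[ℝ] TangentSpace 𝓘(ℝ, E) x →L[ℝ] ℝ) : Prop :=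
  ∀ (y : S.carrier) (a b c d : TangentSpace 𝓘(ℝ, EuclideanSpace ℝ (Fin S.dim)) y),
    riemann (S.inducedMetric g) y a b c d = 0

/-- `g (X, ·) = g' (X, ·)` for all vectors `X` tangent to `S`. -/
def AgreeOn (S : ImmersedSubmanifold E M)
    (g g' : ∀ x : M, TangentSpace 𝓘(ℝ, E) x →L[ℝ] TangentSpace 𝓘(ℝ, E) x →L[ℝ] ℝ) : Prop :=
  ∀ y : S.carrier, ∀ X ∈ S.tangent y, ∀ Y : TangentSpace 𝓘(ℝ, E) (S.toFun y),
    g (S.toFun y) X Y = g' (S.toFun y) X Y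

/-- For `X`, `Y` tangent to `S` at a point `p`, the derivatives at `p`, in all directions of `M`, of
`g (X, Y)` and `g' (X, Y)` are the same, where `X` and `Y` are extended with constant coefficients
in a chart. (If `g (X, ·) = g' (X, ·)` at `p`, the choice of the extensions does not matter.) -/
def AgreeToFirstOrderOn (S : ImmersedSubmanifold E M)
    (g g' : ∀ x : M, TangentSpace 𝓘(ℝ, E) x →L[ℝ] TangentSpace 𝓘(ℝ, E) x →L[ℝ] ℝ) : Prop :=
  ∀ y : S.carrier, ∀ X ∈ S.tangent y, ∀ Y ∈ S.tangent y, ∀ w : E,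
    fderiv ℝ (metricCoeff g (S.toFun y)) (extChartAt 𝓘(ℝ, E) (S.toFun y) (S.toFun y)) w
        (vecCoord (S.toFun y) X) (vecCoord (S.toFun y) Y) =
      fderiv ℝ (metricCoeff g' (S.toFun y)) (extChartAt 𝓘(ℝ, E) (S.toFun y) (S.toFun y)) w
        (vecCoord (S.toFun y) X) (vecCoord (S.toFun y) Y)

end ImmersedSubmanifold

end

/-! Let `span {X, W}` be a zero plane of `g`. It is tangent to some totally geodesic flat `S`, so
the whole vectors `R(X, W)W` and `R(W, X)X` vanish (`ImmersedSubmanifold.riemann_eq_zero`). The same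
holds for `g'`. Agreement along `S` gives the same induced metric, hence flatness. In the Koszul
formula for tangent `u`, `v`, the terms `D_u G(v, w)` and `D_v G(u, w)` are derivatives along `S` of
the known form `G(v, ·)`, while `D_w G(u, v)` is fixed by the first-order hypothesis. So `S` stays
totally geodesic (`IsGeodesicAt.of_agree`).

Hence for both metrics the constant and linear terms of `curv(X + σZ, W + τV)` vanish, and with `(σ,
τ) = r (cos θ, sin θ)` what is left is `r ^ 2` times the quadratic term plus `O(r)`. Curvature is
continuous in the `C²` topology and `Q` times the circle is compact, so this factor is positive for
all metrics near `g` and all small `r`, uniformly over `Q` (`eventually_pencilRemainder_pos`,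
`curv_pencil_pos`).

Planes outside a neighbourhood of the zero planes have positive `g`-curvature; by compactness they
keep positive curvature for metrics near `g` (`eventually_mem_or_curv_pos`). A point of `S` carries
a zero plane because `S` has dimension at least two, so each plane there is outside the
neighbourhood, a zero plane, or a member of a pencil. The sign of the curvature is controlled in all
three cases. -/

set_option maxSynthPendingDepth 3
noncomputable section

/-! ### The Levi-Civita connection and the symmetries of curvature, in coordinates. -/

namespace CoordGeometry

variable {E : Type*} [NormedAddCommGroup E] [NormedSpace ℝ E]
  {E' : Type*} [NormedAddCommGroup E'] [NormedSpace ℝ E']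

/-- `G` is a smooth Riemannian metric, in coordinates, on the open set `U`. -/
structure IsMetricOn (G : E → E →L[ℝ] E →L[ℝ] ℝ) (U : Set E) : Prop where
  isOpen : IsOpen U
  contDiffOn : ContDiffOn ℝ ∞ G U
  symm : ∀ z ∈ U, ∀ u v, G z u v = G z v u
  pos : ∀ z ∈ U, ∀ u, u ≠ 0 → 0 < G z u u

/-- A positive definite form is an isomorphism onto the dual. -/
theorem exists_equiv_of_pos [FiniteDimensional ℝ E] (B : E →L[ℝ] E →L[ℝ] ℝ)
    (hB : ∀ u, u ≠ 0 → 0 < B u u) : ∃ e : E ≃L[ℝ] (E →L[ℝ] ℝ), (e : E →L[ℝ] E →L[ℝ] ℝ) = B := by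
  have hinj : Function.Injective B.toLinearMap := by
    rw [← LinearMap.ker_eq_bot, LinearMap.ker_eq_bot']
    intro u hu
    by_contra h
    have h1 := hB u h
    have h2 : B u = 0 := hu
    rw [h2] at h1
    simp at h1
  have hdim : Module.finrank ℝ E = Module.finrank ℝ (E →L[ℝ] ℝ) := by
    rw [← (LinearMap.toContinuousLinearMap (𝕜 := ℝ) (E := E) (F' := ℝ)).finrank_eq]
    exact (Subspace.dual_finrank_eq (K := ℝ) (V := E)).symm
  refine ⟨(LinearMap.linearEquivOfInjective B.toLinearMap hinj hdim).toContinuousLinearEquiv, ?_⟩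
  ext u v
  rfl

theorem fderiv_form_apply {F : Type*} [NormedAddCommGroup F] [NormedSpace ℝ F]
    {G : E' → E →L[ℝ] E →L[ℝ] F} {z : E'}
    (hG : DifferentiableAt ℝ G z) (v w : E) (u : E') :
    fderiv ℝ (fun y => G y v w) z u = fderiv ℝ G z u v w := by
  have h := (hG.hasFDerivAt.clm_apply (hasFDerivAt_const v z)).clm_apply (hasFDerivAt_const w z)
  rw [h.fderiv]
  simp

/-- The Christoffel map as a continuous bilinear map. -/
def christoffelL (G : E → E →L[ℝ] E →L[ℝ] ℝ) (z : E) : E →L[ℝ] E →L[ℝ] E :=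
  (ContinuousLinearMap.compL ℝ E (E →L[ℝ] ℝ) E (G z).inverse) ∘L
    ((1 / 2 : ℝ) • (fderiv ℝ G z + (fderiv ℝ G z).flip
      - (ContinuousLinearMap.flipₗᵢ ℝ E E ℝ).toContinuousLinearEquiv.toContinuousLinearMap ∘L
          (fderiv ℝ G z).flip))

/-- Used backwards, to get additivity and homogeneity of `christoffel` in its slots. -/
theorem christoffelL_apply (G : E → E →L[ℝ] E →L[ℝ] ℝ) (z u v : E) :
    christoffelL G z u v = christoffel G z u v := rfl

namespace IsMetricOn

variable {G : E → E →L[ℝ] E →L[ℝ] ℝ} {U : Set E}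

theorem contDiffAt (h : IsMetricOn G U) {z : E} (hz : z ∈ U) : ContDiffAt ℝ ∞ G z :=
  h.contDiffOn.contDiffAt (h.isOpen.mem_nhds hz)

theorem contDiffAt_fderiv (h : IsMetricOn G U) {z : E} (hz : z ∈ U) :
    ContDiffAt ℝ ∞ (fderiv ℝ G) z :=
  (h.contDiffAt hz).fderiv_right (m := ∞) (by simp)

theorem differentiableAt (h : IsMetricOn G U) {z : E} (hz : z ∈ U) : DifferentiableAt ℝ G z :=
  (h.contDiffAt hz).differentiableAt (by simp)

theorem differentiableAt_fderiv (h : IsMetricOn G U) {z : E} (hz : z ∈ U) :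
    DifferentiableAt ℝ (fderiv ℝ G) z :=
  (h.contDiffAt_fderiv hz).differentiableAt (by simp)

/-- Nondegeneracy. Identities between Christoffel vectors are proved by testing against every `w`,
where the Koszul formula applies. -/
theorem injective (h : IsMetricOn G U) {z : E} (hz : z ∈ U) {a b : E}
    (hab : ∀ w, G z a w = G z b w) : a = b := by
  by_contra hne
  have := h.pos z hz (a - b) (sub_ne_zero.2 hne)
  simp [hab] at this

theorem fderiv_symm (h : IsMetricOn G U) {z : E} (hz : z ∈ U) (u v w : E) :
    fderiv ℝ G z u v w = fderiv ℝ G z u w v := by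
  rw [← fderiv_form_apply (h.differentiableAt hz), ← fderiv_form_apply (h.differentiableAt hz)]
  have : (fun y => G y v w) =ᶠ[𝓝 z] fun y => G y w v :=
    Filter.eventually_of_mem (h.isOpen.mem_nhds hz) fun y hy => h.symm y hy v w
  rw [this.fderiv_eq]

theorem fderiv_fderiv_apply (h : IsMetricOn G U) {z : E} (hz : z ∈ U) (a u v w : E) :
    fderiv ℝ (fun y => fderiv ℝ G y u v w) z a = fderiv ℝ (fderiv ℝ G) z a u v w := by
  have h1 := (((h.differentiableAt_fderiv hz).hasFDerivAt.clm_apply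
    (hasFDerivAt_const u z)).clm_apply (hasFDerivAt_const v z)).clm_apply (hasFDerivAt_const w z)
  rw [h1.fderiv]
  simp

theorem fderiv_fderiv_symm_right (h : IsMetricOn G U) {z : E} (hz : z ∈ U) (a u v w : E) :
    fderiv ℝ (fderiv ℝ G) z a u v w = fderiv ℝ (fderiv ℝ G) z a u w v := by
  rw [← h.fderiv_fderiv_apply hz, ← h.fderiv_fderiv_apply hz]
  have : (fun y => fderiv ℝ G y u v w) =ᶠ[𝓝 z] fun y => fderiv ℝ G y u w v :=
    Filter.eventually_of_mem (h.isOpen.mem_nhds hz) fun y hy => h.fderiv_symm hy u v w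
  rw [this.fderiv_eq]

theorem fderiv_fderiv_symm_left (h : IsMetricOn G U) {z : E} (hz : z ∈ U) (a u v w : E) :
    fderiv ℝ (fderiv ℝ G) z a u v w = fderiv ℝ (fderiv ℝ G) z u a v w := by
  have := (h.contDiffAt hz).isSymmSndFDerivAt
    (by rw [minSmoothness_of_isRCLikeNormedField]; exact ENat.LEInfty.out)
  rw [this.eq a u]

variable [FiniteDimensional ℝ E]

theorem contDiffAt_christoffelL (h : IsMetricOn G U) {z : E} (hz : z ∈ U) :
    ContDiffAt ℝ ∞ (christoffelL G) z := by
  obtain ⟨e, he⟩ := exists_equiv_of_pos (G z) (h.pos z hz)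
  have h1 : ContDiffAt ℝ ∞ (fun y => (G y).inverse) z := by
    have h2 := contDiffAt_map_inverse (n := ∞) e
    rw [he] at h2
    exact h2.comp z (h.contDiffAt hz)
  have h3 := h.contDiffAt_fderiv hz
  have h4 : ContDiffAt ℝ ∞ (fun y => (fderiv ℝ G y).flip) z :=
    (ContinuousLinearMap.flipₗᵢ ℝ E E (E →L[ℝ] ℝ)).toContinuousLinearEquiv.contDiff.contDiffAt.comp
      z h3
  unfold christoffelL
  refine ContDiffAt.clm_comp ?_ ?_
  · exact (ContinuousLinearMap.compL ℝ E (E →L[ℝ] ℝ) E).contDiff.contDiffAt.comp z h1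
  · exact ((h3.add h4).sub (contDiffAt_const.clm_comp h4)).const_smul _

theorem differentiableAt_christoffelL (h : IsMetricOn G U) {z : E} (hz : z ∈ U) :
    DifferentiableAt ℝ (christoffelL G) z :=
  (h.contDiffAt_christoffelL hz).differentiableAt (by simp)

theorem fderiv_christoffel (h : IsMetricOn G U) {z : E} (hz : z ∈ U) (u v w : E) :
    fderiv ℝ (fun y => christoffel G y v w) z u = fderiv ℝ (christoffelL G) z u v w :=
  fderiv_form_apply (h.differentiableAt_christoffelL hz) v w u

/-- `ContinuousLinearMap.inverse` is zero at a map that is not invertible, so the defining property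
rests on positive definiteness and finite dimension. -/
theorem apply_christoffel (h : IsMetricOn G U) {z : E} (hz : z ∈ U) (u v : E) :
    G z (christoffel G z u v) = christoffelFirst G z u v := by
  obtain ⟨e, he⟩ := exists_equiv_of_pos (G z) (h.pos z hz)
  rw [christoffel, ← he, ContinuousLinearMap.inverse_equiv]
  exact e.apply_symm_apply _

omit [FiniteDimensional ℝ E] in
theorem christoffelFirst_apply (G : E → E →L[ℝ] E →L[ℝ] ℝ) (z u v w : E) :
    christoffelFirst G z u v w =
      (fderiv ℝ G z u v w + fderiv ℝ G z v u w - fderiv ℝ G z w u v) / 2 := by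
  simp [christoffelFirst]
  ring

theorem christoffel_symm (h : IsMetricOn G U) {z : E} (hz : z ∈ U) (u v : E) :
    christoffel G z u v = christoffel G z v u := by
  apply h.injective hz
  intro w
  rw [h.apply_christoffel hz, h.apply_christoffel hz, christoffelFirst_apply,
    christoffelFirst_apply, h.fderiv_symm hz w u v]
  ring

/-- Differentiating `G(Γ(v, w), x)`, which is a combination of first derivatives of `G`, avoids
differentiating the inverse of `G`. -/
theorem apply_fderiv_christoffel (h : IsMetricOn G U) {z : E} (hz : z ∈ U) (u v w x : E) :
    G z (fderiv ℝ (fun y => christoffel G y v w) z u) x =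
      (fderiv ℝ (fderiv ℝ G) z u v w x + fderiv ℝ (fderiv ℝ G) z u w v x
        - fderiv ℝ (fderiv ℝ G) z u x v w) / 2 - fderiv ℝ G z u (christoffel G z v w) x := by
  have hc : DifferentiableAt ℝ (fun y => christoffel G y v w) z := by
    have h1 := ((h.differentiableAt_christoffelL hz).hasFDerivAt.clm_apply
      (hasFDerivAt_const v z)).clm_apply (hasFDerivAt_const w z)
    exact h1.differentiableAt
  have hL := ((h.differentiableAt hz).hasFDerivAt.clm_apply hc.hasFDerivAt).clm_apply
    (hasFDerivAt_const x z)
  have heq : (fun y => G y (christoffel G y v w) x) =ᶠ[𝓝 z] fun y =>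
      (fderiv ℝ G y v w x + fderiv ℝ G y w v x - fderiv ℝ G y x v w) / 2 :=
    Filter.eventually_of_mem (h.isOpen.mem_nhds hz) fun y hy => by
      simp only [h.apply_christoffel hy, christoffelFirst_apply]
  have hd : ∀ a b c : E, HasFDerivAt (fun y => fderiv ℝ G y a b c)
      (fderiv ℝ (fun y => fderiv ℝ G y a b c) z) z := fun a b c =>
    ((((h.differentiableAt_fderiv hz).hasFDerivAt.clm_apply
      (hasFDerivAt_const a z)).clm_apply (hasFDerivAt_const b z)).clm_apply
      (hasFDerivAt_const c z)).differentiableAt.hasFDerivAt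
  have hR := ((((hd v w x).add (hd w v x)).sub (hd x v w)).mul_const (2⁻¹ : ℝ))
  have e1 := hL.fderiv
  have e2 : fderiv ℝ (fun y => G y (christoffel G y v w) x) z = _ :=
    heq.fderiv_eq.trans (by simpa [div_eq_mul_inv] using hR.fderiv)
  have e3 := congrArg (fun T : E →L[ℝ] ℝ => T u) (e1.symm.trans e2)
  simp [h.fderiv_fderiv_apply hz] at e3
  linarith

/-- Compatibility of the connection with the metric. -/
theorem fderiv_eq_christoffelFirst (h : IsMetricOn G U) {z : E} (hz : z ∈ U) (u a x : E) :
    fderiv ℝ G z u a x = G z (christoffel G z u a) x + G z (christoffel G z u x) a := by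
  rw [h.apply_christoffel hz, h.apply_christoffel hz, christoffelFirst_apply,
    christoffelFirst_apply, h.fderiv_symm hz u x a, h.fderiv_symm hz x u a,
    h.fderiv_symm hz a u x]
  ring

/-- The curvature tensor in terms of the two-jet of the metric. -/
theorem curvatureTensor_eq (h : IsMetricOn G U) {z : E} (hz : z ∈ U) (u v w x : E) :
    curvatureTensor G z u v w x =
      (fderiv ℝ (fderiv ℝ G) z u w v x + fderiv ℝ (fderiv ℝ G) z v x u w
        - fderiv ℝ (fderiv ℝ G) z u x v w - fderiv ℝ (fderiv ℝ G) z v w u x) / 2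
      + G z (christoffel G z v x) (christoffel G z u w)
      - G z (christoffel G z u x) (christoffel G z v w) := by
  unfold curvatureTensor curvatureOp
  simp only [map_add, map_sub, add_apply, sub_apply]
  rw [h.apply_fderiv_christoffel hz, h.apply_fderiv_christoffel hz,
    h.fderiv_eq_christoffelFirst hz, h.fderiv_eq_christoffelFirst hz,
    h.fderiv_fderiv_symm_left hz u v]
  ring

/-- Visible on the two-jet formula, once second derivatives, `G` and `Γ` are known to be symmetric.
-/
theorem curvatureTensor_pair_symm (h : IsMetricOn G U) {z : E} (hz : z ∈ U) (u v w x : E) :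
    curvatureTensor G z u v w x = curvatureTensor G z w x u v := by
  rw [h.curvatureTensor_eq hz, h.curvatureTensor_eq hz,
    h.fderiv_fderiv_symm_left hz w u, h.fderiv_fderiv_symm_left hz x v,
    h.fderiv_fderiv_symm_left hz w v, h.fderiv_fderiv_symm_left hz x u,
    h.fderiv_fderiv_symm_right hz u w x v, h.fderiv_fderiv_symm_right hz v x w u,
    h.fderiv_fderiv_symm_right hz v w x u, h.fderiv_fderiv_symm_right hz u x w v,
    h.christoffel_symm hz x v, h.christoffel_symm hz w u, h.christoffel_symm hz w v,
    h.christoffel_symm hz x u, h.symm z hz (christoffel G z v w)]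
  ring

omit [FiniteDimensional ℝ E] in
theorem curvatureTensor_antisymm (G : E → E →L[ℝ] E →L[ℝ] ℝ) (z u v w x : E) :
    curvatureTensor G z u v w x = - curvatureTensor G z v u w x := by
  unfold curvatureTensor curvatureOp
  simp only [map_add, map_sub, add_apply, sub_apply]
  ring

end IsMetricOn

end CoordGeometry

/-! ### Connection and curvature under immersions with vanishing second fundamental form. -/

namespace CoordGeometry

variable {E : Type*} [NormedAddCommGroup E] [NormedSpace ℝ E]
  {E' : Type*} [NormedAddCommGroup E'] [NormedSpace ℝ E']

/-- `H` is, on the open set `V`, the pullback of the metric `G` by the smooth immersion `F`. -/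
structure IsPullbackOn (H : E' → E' →L[ℝ] E' →L[ℝ] ℝ) (G : E → E →L[ℝ] E →L[ℝ] ℝ) (F : E' → E)
    (V : Set E') (U : Set E) : Prop where
  metric : IsMetricOn G U
  isOpen : IsOpen V
  contDiffOn : ContDiffOn ℝ ∞ F V
  mapsTo : MapsTo F V U
  injective : ∀ z ∈ V, Function.Injective (fderiv ℝ F z)
  eq : ∀ z ∈ V, H z = pullbackForm (G (F z)) (fderiv ℝ F z)

/-- The second fundamental form of `F` vanishes at `z`. -/
def IsGeodesicAt (G : E → E →L[ℝ] E →L[ℝ] ℝ) (F : E' → E) (z : E') : Prop :=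
  ∀ u v : E', fderiv ℝ (fderiv ℝ F) z u v
    + christoffel G (F z) (fderiv ℝ F z u) (fderiv ℝ F z v)
      ∈ LinearMap.range (fderiv ℝ F z).toLinearMap

theorem contDiffAt_fderiv_infty {F : E' → E} {V : Set E'} (hV : IsOpen V)
    (hF : ContDiffOn ℝ ∞ F V) {z : E'} (hz : z ∈ V) : ContDiffAt ℝ ∞ (fderiv ℝ F) z :=
  (hF.contDiffAt (hV.mem_nhds hz)).fderiv_right (m := ∞) (by simp)

namespace IsPullbackOn

variable {H : E' → E' →L[ℝ] E' →L[ℝ] ℝ} {G : E → E →L[ℝ] E →L[ℝ] ℝ} {F : E' → E}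
    {V : Set E'} {U : Set E}

theorem contDiffAt (h : IsPullbackOn H G F V U) {z : E'} (hz : z ∈ V) : ContDiffAt ℝ ∞ F z :=
  h.contDiffOn.contDiffAt (h.isOpen.mem_nhds hz)

theorem hasFDerivAt (h : IsPullbackOn H G F V U) {z : E'} (hz : z ∈ V) :
    HasFDerivAt F (fderiv ℝ F z) z :=
  ((h.contDiffAt hz).differentiableAt (by simp)).hasFDerivAt

theorem contDiffAt_fderiv (h : IsPullbackOn H G F V U) {z : E'} (hz : z ∈ V) :
    ContDiffAt ℝ ∞ (fderiv ℝ F) z :=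
  contDiffAt_fderiv_infty h.isOpen h.contDiffOn hz

theorem hasFDerivAt_fderiv (h : IsPullbackOn H G F V U) {z : E'} (hz : z ∈ V) :
    HasFDerivAt (fderiv ℝ F) (fderiv ℝ (fderiv ℝ F) z) z :=
  ((h.contDiffAt_fderiv hz).differentiableAt (by simp)).hasFDerivAt

theorem hasFDerivAt_fderiv_fderiv (h : IsPullbackOn H G F V U) {z : E'} (hz : z ∈ V) :
    HasFDerivAt (fderiv ℝ (fderiv ℝ F)) (fderiv ℝ (fderiv ℝ (fderiv ℝ F)) z) z :=
  (((h.contDiffAt_fderiv hz).fderiv_right (m := ∞) (by simp)).differentiableAt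
    (by simp)).hasFDerivAt

theorem snd_symm (h : IsPullbackOn H G F V U) {z : E'} (hz : z ∈ V) (u v : E') :
    fderiv ℝ (fderiv ℝ F) z u v = fderiv ℝ (fderiv ℝ F) z v u :=
  ((h.contDiffAt hz).isSymmSndFDerivAt
    (by rw [minSmoothness_of_isRCLikeNormedField]; exact ENat.LEInfty.out)).eq u v

theorem third_symm (h : IsPullbackOn H G F V U) {z : E'} (hz : z ∈ V) (u v w : E') :
    fderiv ℝ (fderiv ℝ (fderiv ℝ F)) z u v w = fderiv ℝ (fderiv ℝ (fderiv ℝ F)) z v u w := by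
  rw [((h.contDiffAt_fderiv hz).isSymmSndFDerivAt
    (by rw [minSmoothness_of_isRCLikeNormedField]; exact ENat.LEInfty.out)).eq u v]

theorem apply (h : IsPullbackOn H G F V U) {z : E'} (hz : z ∈ V) (u v : E') :
    H z u v = G (F z) (fderiv ℝ F z u) (fderiv ℝ F z v) := by
  rw [h.eq z hz, pullbackForm_apply]

theorem isMetricOn (h : IsPullbackOn H G F V U) : IsMetricOn H V where
  isOpen := h.isOpen
  contDiffOn := by
    intro z hz
    apply ContDiffAt.contDiffWithinAt
    have h1 : ContDiffAt ℝ ∞ (fun y => G (F y)) z :=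
      (h.metric.contDiffAt (h.mapsTo hz)).comp z (h.contDiffAt hz)
    have h2 := h.contDiffAt_fderiv hz
    have h3 : ContDiffAt ℝ ∞ (fun y => pullbackForm (G (F y)) (fderiv ℝ F y)) z := by
      unfold pullbackForm
      refine ContDiffAt.clm_comp ?_ (h1.clm_comp h2)
      exact ((ContinuousLinearMap.compL ℝ E' E ℝ).flip).contDiff.contDiffAt.comp z h2
    exact h3.congr_of_eventuallyEq
      (Filter.eventually_of_mem (h.isOpen.mem_nhds hz) fun y hy => h.eq y hy)
  symm z hz u v := by
    rw [h.apply hz, h.apply hz, h.metric.symm _ (h.mapsTo hz)]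
  pos z hz u hu := by
    rw [h.apply hz]
    apply h.metric.pos _ (h.mapsTo hz)
    intro h0
    exact hu (h.injective z hz (by rw [h0, map_zero]))

theorem fderiv_apply (h : IsPullbackOn H G F V U) {z : E'} (hz : z ∈ V) (u v w : E') :
    fderiv ℝ H z u v w = fderiv ℝ G (F z) (fderiv ℝ F z u) (fderiv ℝ F z v) (fderiv ℝ F z w)
      + G (F z) (fderiv ℝ (fderiv ℝ F) z u v) (fderiv ℝ F z w)
      + G (F z) (fderiv ℝ F z v) (fderiv ℝ (fderiv ℝ F) z u w) := by
  rw [← fderiv_form_apply (h.isMetricOn.differentiableAt hz)]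
  have heq : (fun y => H y v w) =ᶠ[𝓝 z] fun y => G (F y) (fderiv ℝ F y v) (fderiv ℝ F y w) :=
    Filter.eventually_of_mem (h.isOpen.mem_nhds hz) fun y hy => h.apply hy v w
  have hc := (h.metric.differentiableAt (h.mapsTo hz)).hasFDerivAt.comp z (h.hasFDerivAt hz)
  have hd := fun a : E' => (h.hasFDerivAt_fderiv hz).clm_apply (hasFDerivAt_const a z)
  have hL := (hc.clm_apply (hd v)).clm_apply (hd w)
  rw [heq.fderiv_eq]
  erw [hL.fderiv]
  simp
  ring

variable [FiniteDimensional ℝ E] [FiniteDimensional ℝ E']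

/-- The Gauss formula: the induced connection is the tangential part of the ambient one. In the
Koszul combination of three derivatives of `H`, the second derivatives of `F` cancel except `D²F(u,
v)`. -/
theorem apply_fderiv_christoffel (h : IsPullbackOn H G F V U) {z : E'} (hz : z ∈ V)
    (u v w : E') :
    G (F z) (fderiv ℝ F z (christoffel H z u v)) (fderiv ℝ F z w) =
      G (F z) (fderiv ℝ (fderiv ℝ F) z u v
        + christoffel G (F z) (fderiv ℝ F z u) (fderiv ℝ F z v)) (fderiv ℝ F z w) := by
  rw [← h.apply hz, h.isMetricOn.apply_christoffel hz, map_add, add_apply,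
    h.metric.apply_christoffel (h.mapsTo hz), IsMetricOn.christoffelFirst_apply,
    IsMetricOn.christoffelFirst_apply, h.fderiv_apply hz, h.fderiv_apply hz, h.fderiv_apply hz,
    h.snd_symm hz v u, h.snd_symm hz w u, h.snd_symm hz w v,
    h.metric.symm _ (h.mapsTo hz) (fderiv ℝ (fderiv ℝ F) z u w)]
  ring

/-- With no normal component left, the Gauss formula becomes an identity of vectors instead of one
tested on tangent vectors. -/
theorem fderiv_christoffel (h : IsPullbackOn H G F V U) {z : E'} (hz : z ∈ V)
    (hgeo : IsGeodesicAt G F z) (u v : E') :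
    fderiv ℝ F z (christoffel H z u v) = fderiv ℝ (fderiv ℝ F) z u v
        + christoffel G (F z) (fderiv ℝ F z u) (fderiv ℝ F z v) := by
  obtain ⟨a, ha⟩ := hgeo u v
  have ha' : fderiv ℝ F z a = _ := ha
  rw [← ha']
  congr 1
  apply h.isMetricOn.injective hz
  intro w
  rw [h.apply hz, h.apply hz, h.apply_fderiv_christoffel hz, ha']

/-- The identity `dF(Γ_H) = D²F + Γ_G(dF, dF)` holds on all of `V`, so it can be differentiated once
more; antisymmetrizing in `u`, `v` removes the third derivatives of `F`. -/
theorem curvatureOp (h : IsPullbackOn H G F V U) (hgeo : ∀ z ∈ V, IsGeodesicAt G F z)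
    {z : E'} (hz : z ∈ V) (u v w : E') :
    fderiv ℝ F z (curvatureOp H z u v w) =
      CoordGeometry.curvatureOp G (F z) (fderiv ℝ F z u) (fderiv ℝ F z v) (fderiv ℝ F z w) := by
  have hG := h.metric
  have hFz := h.mapsTo hz
  have hH := h.isMetricOn
  have hd := fun a : E' => (h.hasFDerivAt_fderiv hz).clm_apply (hasFDerivAt_const a z)
  have key : ∀ u v w : E',
      fderiv ℝ (fderiv ℝ F) z u (christoffel H z v w)
        + fderiv ℝ F z (fderiv ℝ (fun y => christoffel H y v w) z u) =
      fderiv ℝ (fderiv ℝ (fderiv ℝ F)) z u v w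
        + (fderiv ℝ (christoffelL G) (F z) (fderiv ℝ F z u) (fderiv ℝ F z v) (fderiv ℝ F z w)
          + christoffel G (F z) (fderiv ℝ (fderiv ℝ F) z u v) (fderiv ℝ F z w)
          + christoffel G (F z) (fderiv ℝ F z v) (fderiv ℝ (fderiv ℝ F) z u w)) := by
    intro u v w
    have heq : (fun y => fderiv ℝ F y (christoffel H y v w)) =ᶠ[𝓝 z] fun y =>
        fderiv ℝ (fderiv ℝ F) y v w
          + christoffelL G (F y) (fderiv ℝ F y v) (fderiv ℝ F y w) :=
      Filter.eventually_of_mem (h.isOpen.mem_nhds hz) fun y hy =>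
        h.fderiv_christoffel hy (hgeo y hy) v w
    have hcH : HasFDerivAt (fun y => christoffel H y v w)
        (fderiv ℝ (fun y => christoffel H y v w) z) z :=
      (((hH.differentiableAt_christoffelL hz).hasFDerivAt.clm_apply
        (hasFDerivAt_const v z)).clm_apply (hasFDerivAt_const w z)).differentiableAt.hasFDerivAt
    have hL := (h.hasFDerivAt_fderiv hz).clm_apply hcH
    have hcG := (hG.differentiableAt_christoffelL hFz).hasFDerivAt.comp z (h.hasFDerivAt hz)
    have hR := (((h.hasFDerivAt_fderiv_fderiv hz).clm_apply
      (hasFDerivAt_const v z)).clm_apply (hasFDerivAt_const w z)).add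
        ((hcG.clm_apply (hd v)).clm_apply (hd w))
    have e := (hL.fderiv.symm.trans heq.fderiv_eq).trans hR.fderiv
    have e' := congrArg (fun T : E' →L[ℝ] E => T u) e
    simp [christoffelL_apply] at e'
    rw [add_comm, e']
    abel
  have k1 := key u v w
  have k2 := key v u w
  unfold CoordGeometry.curvatureOp
  rw [hG.fderiv_christoffel hFz, hG.fderiv_christoffel hFz]
  simp only [map_add, map_sub]
  rw [h.fderiv_christoffel hz (hgeo z hz) u (christoffel H z v w),
    h.fderiv_christoffel hz (hgeo z hz) v (christoffel H z u w),
    h.fderiv_christoffel hz (hgeo z hz) v w, h.fderiv_christoffel hz (hgeo z hz) u w]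
  rw [eq_sub_of_add_eq' k1, eq_sub_of_add_eq' k2, h.third_symm hz v u, h.snd_symm hz v u]
  simp only [← christoffelL_apply, map_add]
  abel

theorem curvatureTensor (h : IsPullbackOn H G F V U) (hgeo : ∀ z ∈ V, IsGeodesicAt G F z)
    {z : E'} (hz : z ∈ V) (u v w x : E') :
    curvatureTensor H z u v w x = CoordGeometry.curvatureTensor G (F z)
      (fderiv ℝ F z u) (fderiv ℝ F z v) (fderiv ℝ F z w) (fderiv ℝ F z x) := by
  unfold CoordGeometry.curvatureTensor
  rw [h.apply hz, h.curvatureOp hgeo hz]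

-- Makes the results above apply to changes of charts, where they say that curvature is a tensor.
omit [FiniteDimensional ℝ E] [FiniteDimensional ℝ E'] in
theorem isGeodesicAt_of_surjective {z : E'} (hs : Function.Surjective (fderiv ℝ F z)) :
    IsGeodesicAt G F z := fun _ _ => hs _

end IsPullbackOn

end CoordGeometry

/-! ### Metric coefficients in charts, and independence of curvature from the chart. -/

section Manifold

open CoordGeometry

variable {E : Type*} [NormedAddCommGroup E] [NormedSpace ℝ E]
  {E' : Type*} [NormedAddCommGroup E'] [NormedSpace ℝ E']
  {M : Type*} [TopologicalSpace M] [ChartedSpace E M]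

/-- The pullback of a field of bilinear forms by a map from a vector space. -/
def pullbackField (g : ∀ x : M, TangentSpace 𝓘(ℝ, E) x →L[ℝ] TangentSpace 𝓘(ℝ, E) x →L[ℝ] ℝ)
    (f : E' → M) (z : E') : E' →L[ℝ] E' →L[ℝ] ℝ :=
  pullbackForm (g (f z)) (mfderiv 𝓘(ℝ, E') 𝓘(ℝ, E) f z)

section

variable (g : ∀ x : M, TangentSpace 𝓘(ℝ, E) x →L[ℝ] TangentSpace 𝓘(ℝ, E) x →L[ℝ] ℝ)

theorem pullbackField_extChartAt_symm (c : M) :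
    pullbackField g (extChartAt 𝓘(ℝ, E) c).symm = metricCoeff g c := rfl

/-- All tangent spaces are definitionally `E`, so the foot point can be changed while the vectors
stay. -/
theorem form_congr {x x' : M} (h : x = x') (u v : E) :
    g x u v = g x' u v := by
  subst h; rfl

theorem pullbackField_congr {f f' : E' → M} {z : E'} (h : f =ᶠ[𝓝 z] f') :
    pullbackField g f z = pullbackField g f' z := by
  ext u v
  have h1 : ∀ a : E', (mfderiv 𝓘(ℝ, E') 𝓘(ℝ, E) f z a : E) = mfderiv 𝓘(ℝ, E') 𝓘(ℝ, E) f' z a :=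
    fun a => congrArg (fun T : E' →L[ℝ] E => T a) (h.mfderiv_eq (I := 𝓘(ℝ, E')) (I' := 𝓘(ℝ, E)))
  change g (f z) (mfderiv 𝓘(ℝ, E') 𝓘(ℝ, E) f z u : E) (mfderiv 𝓘(ℝ, E') 𝓘(ℝ, E) f z v : E) =
    g (f' z) (mfderiv 𝓘(ℝ, E') 𝓘(ℝ, E) f' z u : E) (mfderiv 𝓘(ℝ, E') 𝓘(ℝ, E) f' z v : E)
  exact (form_congr g h.eq_of_nhds _ _).trans
    (congrArg₂ (fun a b : E => g (f' z) a b) (h1 u) (h1 v))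

theorem pullbackField_comp {f : E → M} {F : E' → E} {z : E'}
    (hf : MDifferentiableAt 𝓘(ℝ, E) 𝓘(ℝ, E) f (F z)) (hF : DifferentiableAt ℝ F z) :
    pullbackField g (f ∘ F) z = pullbackForm (pullbackField g f (F z)) (fderiv ℝ F z) := by
  ext u v
  have h1 : mfderiv 𝓘(ℝ, E') 𝓘(ℝ, E) (f ∘ F) z =
      (mfderiv 𝓘(ℝ, E) 𝓘(ℝ, E) f (F z)).comp (mfderiv 𝓘(ℝ, E') 𝓘(ℝ, E) F z) :=
    mfderiv_comp z hf hF.mdifferentiableAt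
  rw [mfderiv_eq_fderiv] at h1
  unfold pullbackField
  rw [h1]
  rfl

end

variable [IsManifold 𝓘(ℝ, E) ∞ M]

theorem isManifold_one (E : Type*) [NormedAddCommGroup E] [NormedSpace ℝ E]
    (M : Type*) [TopologicalSpace M] [ChartedSpace E M] [IsManifold 𝓘(ℝ, E) ∞ M] :
    IsManifold 𝓘(ℝ, E) 1 M := IsManifold.of_le (n := ∞) ENat.LEInfty.out

theorem mdifferentiableAt_extChartAt_symm' {c : M} {z : E}
    (hz : z ∈ (extChartAt 𝓘(ℝ, E) c).target) :
    MDifferentiableAt 𝓘(ℝ, E) 𝓘(ℝ, E) (extChartAt 𝓘(ℝ, E) c).symm z :=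
  ((contMDiffOn_extChartAt_symm (n := ∞) c).contMDiffAt
    ((isOpen_extChartAt_target c).mem_nhds hz)).mdifferentiableAt (by simp)

theorem mdifferentiableAt_extChartAt_of_mem {c p : M} (hp : p ∈ (chartAt E c).source) :
    MDifferentiableAt 𝓘(ℝ, E) 𝓘(ℝ, E) (extChartAt 𝓘(ℝ, E) c) p :=
  (contMDiffAt_extChartAt' (n := ∞) hp).mdifferentiableAt (by simp)

theorem isInvertible_mfderiv_extChartAt_symm {c : M} {z : E}
    (hz : z ∈ (extChartAt 𝓘(ℝ, E) c).target) :
    (mfderiv 𝓘(ℝ, E) 𝓘(ℝ, E) (extChartAt 𝓘(ℝ, E) c).symm z).IsInvertible := by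
  have := isManifold_one E M
  have := isInvertible_mfderivWithin_extChartAt_symm (I := 𝓘(ℝ, E)) hz
  simpa [mfderivWithin_univ] using this

theorem injective_of_isInvertible {V W : Type*} [AddCommGroup V] [Module ℝ V] [TopologicalSpace V]
    [AddCommGroup W] [Module ℝ W] [TopologicalSpace W] {f : V →L[ℝ] W} (h : f.IsInvertible) :
    Function.Injective f := by
  obtain ⟨e, rfl⟩ := h
  exact e.injective

theorem surjective_of_isInvertible {V W : Type*} [AddCommGroup V] [Module ℝ V]
    [TopologicalSpace V] [AddCommGroup W] [Module ℝ W] [TopologicalSpace W] {f : V →L[ℝ] W}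
    (h : f.IsInvertible) : Function.Surjective f := by
  obtain ⟨e, rfl⟩ := h
  exact e.surjective

theorem contDiffOn_metricCoeff [FiniteDimensional ℝ E] (g : SmoothMetric E M) (c : M) :
    ContDiffOn ℝ ∞ (metricCoeff g.inner c) (extChartAt 𝓘(ℝ, E) c).target := by
  have := isManifold_one E M
  have hopen := isOpen_extChartAt_target (I := 𝓘(ℝ, E)) c
  have hs := contMDiffOn_extChartAt_symm (I := 𝓘(ℝ, E)) (n := ∞) c
  -- The coordinate field with constant coefficients `u` is a smooth section: it is the tangent map
  -- of the inverse chart applied to the constant field `u`. The coefficients are the smooth form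
  -- `g` evaluated on two such fields.
  have hvec : ∀ u : E, ContMDiffOn 𝓘(ℝ, E) 𝓘(ℝ, E).tangent ∞
      (fun z => (⟨(extChartAt 𝓘(ℝ, E) c).symm z,
        mfderiv 𝓘(ℝ, E) 𝓘(ℝ, E) (extChartAt 𝓘(ℝ, E) c).symm z u⟩ : TangentBundle 𝓘(ℝ, E) M))
      (extChartAt 𝓘(ℝ, E) c).target := by
    intro u
    have h1 := hs.contMDiffOn_tangentMapWithin (m := ∞) (by simp) hopen.uniqueMDiffOn
    have h2 : ContMDiffOn 𝓘(ℝ, E) 𝓘(ℝ, E).tangent ∞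
        (fun z : E => (⟨z, u⟩ : TangentBundle 𝓘(ℝ, E) E)) (extChartAt 𝓘(ℝ, E) c).target :=
      contMDiffOn_vectorSpace_iff_contDiffOn.2 contDiffOn_const
    have h3 := h1.comp h2 (fun z hz => hz)
    refine h3.congr fun z hz => ?_
    simp only [Function.comp, tangentMapWithin]
    rw [mfderivWithin_of_isOpen hopen hz]
  rw [contDiffOn_clm_apply]
  intro u
  rw [contDiffOn_clm_apply]
  intro v
  have h := ContMDiffOn.clm_bundle_apply₂ (F₁ := E) (F₂ := E) (F₃ := ℝ)
    (E₃ := Bundle.Trivial M ℝ)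
    (g.contMDiff.comp_contMDiffOn hs) (hvec u) (hvec v)
  rw [← contMDiffOn_iff_contDiffOn]
  intro z hz
  have h' := h z hz
  simp only [Bundle.contMDiffWithinAt_totalSpace] at h'
  exact h'.2

theorem isMetricOn_metricCoeff [FiniteDimensional ℝ E] (g : SmoothMetric E M) (c : M) :
    IsMetricOn (metricCoeff g.inner c) (extChartAt 𝓘(ℝ, E) c).target where
  isOpen := isOpen_extChartAt_target c
  contDiffOn := contDiffOn_metricCoeff g c
  symm _ _ _ _ := g.symm _ _ _
  pos z hz u hu := by
    apply g.pos
    intro h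
    exact hu (injective_of_isInvertible (isInvertible_mfderiv_extChartAt_symm hz)
      (h.trans (map_zero _).symm))

/-- An immersion of an open subset of a vector space into a Riemannian manifold, in a chart. -/
theorem isPullbackOn_extChartAt_comp [FiniteDimensional ℝ E] (g : SmoothMetric E M) (c : M)
    {f : E' → M} {V : Set E'} (hV : IsOpen V) (hf : ContMDiffOn 𝓘(ℝ, E') 𝓘(ℝ, E) ∞ f V)
    (hmaps : MapsTo f V (chartAt E c).source)
    (hinj : ∀ z ∈ V, Function.Injective (mfderiv 𝓘(ℝ, E') 𝓘(ℝ, E) f z))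
    {H : E' → E' →L[ℝ] E' →L[ℝ] ℝ} (hH : ∀ z ∈ V, H z = pullbackField g.inner f z) :
    IsPullbackOn H (metricCoeff g.inner c) (extChartAt 𝓘(ℝ, E) c ∘ f) V
      (extChartAt 𝓘(ℝ, E) c).target := by
  have := isManifold_one E M
  have hF : ContDiffOn ℝ ∞ (extChartAt 𝓘(ℝ, E) c ∘ f) V :=
    (contMDiffOn_extChartAt.comp hf hmaps).contDiffOn
  have hmaps' : ∀ z ∈ V, f z ∈ (extChartAt 𝓘(ℝ, E) c).source := fun z hz => by
    rw [extChartAt_source]; exact hmaps hz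
  refine ⟨isMetricOn_metricCoeff g c, hV, hF, ?_, ?_, ?_⟩
  · intro z hz
    exact (extChartAt 𝓘(ℝ, E) c).map_source (hmaps' z hz)
  · intro z hz
    have hfz : MDifferentiableAt 𝓘(ℝ, E') 𝓘(ℝ, E) f z :=
      (hf.contMDiffAt (hV.mem_nhds hz)).mdifferentiableAt (by simp)
    rw [← mfderiv_eq_fderiv, mfderiv_comp z (mdifferentiableAt_extChartAt_of_mem (hmaps hz)) hfz]
    exact (injective_of_isInvertible (isInvertible_mfderiv_extChartAt (hmaps' z hz))).comp
      (hinj z hz)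
  · intro z hz
    have heq : f =ᶠ[𝓝 z] (extChartAt 𝓘(ℝ, E) c).symm ∘ (extChartAt 𝓘(ℝ, E) c ∘ f) :=
      Filter.eventually_of_mem (hV.mem_nhds hz) fun y hy =>
        ((extChartAt 𝓘(ℝ, E) c).left_inv (hmaps' y hy)).symm
    rw [hH z hz, pullbackField_congr g.inner heq, pullbackField_comp g.inner
      (F := extChartAt 𝓘(ℝ, E) c ∘ f) (mdifferentiableAt_extChartAt_symm' ((extChartAt 𝓘(ℝ, E) c).map_source (hmaps' z hz)))
      ((hF.contDiffAt (hV.mem_nhds hz)).differentiableAt (by simp)),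
      pullbackField_extChartAt_symm]

/-- Change of charts. -/
theorem isPullbackOn_chart_change [FiniteDimensional ℝ E] (g : SmoothMetric E M) (c d : M) :
    IsPullbackOn (metricCoeff g.inner c) (metricCoeff g.inner d)
      (extChartAt 𝓘(ℝ, E) d ∘ (extChartAt 𝓘(ℝ, E) c).symm)
      ((extChartAt 𝓘(ℝ, E) c).target ∩ (extChartAt 𝓘(ℝ, E) c).symm ⁻¹' (chartAt E d).source)
      (extChartAt 𝓘(ℝ, E) d).target := by
  refine isPullbackOn_extChartAt_comp g d ?_ ?_ ?_ ?_ ?_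
  · exact (continuousOn_extChartAt_symm c).isOpen_inter_preimage (isOpen_extChartAt_target c)
      (chartAt E d).open_source
  · exact (contMDiffOn_extChartAt_symm c).mono inter_subset_left
  · exact fun z hz => hz.2
  · exact fun z hz => injective_of_isInvertible (isInvertible_mfderiv_extChartAt_symm hz.1)
  · exact fun z _ => rfl

theorem bijective_fderiv_chart_change (c d : M) {z : E} (hz : z ∈ (extChartAt 𝓘(ℝ, E) c).target)
    (hd : (extChartAt 𝓘(ℝ, E) c).symm z ∈ (chartAt E d).source) :
    Function.Bijective (fderiv ℝ (extChartAt 𝓘(ℝ, E) d ∘ (extChartAt 𝓘(ℝ, E) c).symm) z) := by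
  have := isManifold_one E M
  have h1 := isInvertible_mfderiv_extChartAt_symm hz
  have h2 := isInvertible_mfderiv_extChartAt (I := 𝓘(ℝ, E)) (x := d)
    (y := (extChartAt 𝓘(ℝ, E) c).symm z) (by rw [extChartAt_source]; exact hd)
  rw [← mfderiv_eq_fderiv, mfderiv_comp z (mdifferentiableAt_extChartAt_of_mem hd)
    (mdifferentiableAt_extChartAt_symm' hz)]
  exact ⟨(injective_of_isInvertible h2).comp (injective_of_isInvertible h1),
    (surjective_of_isInvertible h2).comp (surjective_of_isInvertible h1)⟩

/-- The coordinate expression, in the preferred chart at `c`, of a tangent vector at `p`. -/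
def vecCoordAt (c p : M) (X : TangentSpace 𝓘(ℝ, E) p) : E :=
  mfderiv 𝓘(ℝ, E) 𝓘(ℝ, E) (extChartAt 𝓘(ℝ, E) c) p X

theorem fderiv_chart_change_vecCoordAt (c d : M) {p : M} (hc : p ∈ (chartAt E c).source)
    (hd : p ∈ (chartAt E d).source) (X : TangentSpace 𝓘(ℝ, E) p) :
    fderiv ℝ (extChartAt 𝓘(ℝ, E) d ∘ (extChartAt 𝓘(ℝ, E) c).symm) (extChartAt 𝓘(ℝ, E) c p)
      (vecCoordAt c p X) = vecCoordAt d p X := by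
  have hc' : p ∈ (extChartAt 𝓘(ℝ, E) c).source := by rw [extChartAt_source]; exact hc
  have hp := (extChartAt 𝓘(ℝ, E) c).left_inv hc'
  have ht := (extChartAt 𝓘(ℝ, E) c).map_source hc'
  have heq : (extChartAt 𝓘(ℝ, E) d ∘ (extChartAt 𝓘(ℝ, E) c).symm) ∘ extChartAt 𝓘(ℝ, E) c
      =ᶠ[𝓝 p] extChartAt 𝓘(ℝ, E) d :=
    Filter.eventually_of_mem ((isOpen_extChartAt_source (I := 𝓘(ℝ, E)) c).mem_nhds hc')
      fun y hy => congrArg (extChartAt 𝓘(ℝ, E) d) ((extChartAt 𝓘(ℝ, E) c).left_inv hy)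
  have h1 := heq.mfderiv_eq (I := 𝓘(ℝ, E)) (I' := 𝓘(ℝ, E))
  have h2 : MDifferentiableAt 𝓘(ℝ, E) 𝓘(ℝ, E)
      (extChartAt 𝓘(ℝ, E) d ∘ (extChartAt 𝓘(ℝ, E) c).symm) (extChartAt 𝓘(ℝ, E) c p) := by
    refine MDifferentiableAt.comp _ ?_ (mdifferentiableAt_extChartAt_symm' ht)
    rw [hp]
    exact mdifferentiableAt_extChartAt_of_mem hd
  rw [mfderiv_comp p h2 (mdifferentiableAt_extChartAt_of_mem hc), mfderiv_eq_fderiv] at h1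
  exact congrArg (fun T : E →L[ℝ] E => T X) h1

/-- The curvature tensor can be computed in any chart. -/
theorem riemann_eq_curvatureTensor [FiniteDimensional ℝ E] (g : SmoothMetric E M) (c : M) {p : M}
    (hc : p ∈ (chartAt E c).source) (X Y Z W : TangentSpace 𝓘(ℝ, E) p) :
    riemann g.inner p X Y Z W = curvatureTensor (metricCoeff g.inner c) (extChartAt 𝓘(ℝ, E) c p)
      (vecCoordAt c p X) (vecCoordAt c p Y) (vecCoordAt c p Z) (vecCoordAt c p W) := by
  have hd := mem_chart_source E p
  have hc' : p ∈ (extChartAt 𝓘(ℝ, E) c).source := by rw [extChartAt_source]; exact hc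
  have hp := (extChartAt 𝓘(ℝ, E) c).left_inv hc'
  have hmem : extChartAt 𝓘(ℝ, E) c p ∈ (extChartAt 𝓘(ℝ, E) c).target ∩
      (extChartAt 𝓘(ℝ, E) c).symm ⁻¹' (chartAt E p).source :=
    ⟨(extChartAt 𝓘(ℝ, E) c).map_source hc', by rw [mem_preimage, hp]; exact hd⟩
  rw [(isPullbackOn_chart_change g c p).curvatureTensor (fun z hz =>
    IsPullbackOn.isGeodesicAt_of_surjective (bijective_fderiv_chart_change c p hz.1 hz.2).2) hmem]
  rw [fderiv_chart_change_vecCoordAt c p hc hd, fderiv_chart_change_vecCoordAt c p hc hd,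
    fderiv_chart_change_vecCoordAt c p hc hd, fderiv_chart_change_vecCoordAt c p hc hd]
  simp only [Function.comp, hp]
  rfl

end Manifold

/-! ### Invariance of the vanishing of the second fundamental form. -/

namespace CoordGeometry

variable {E : Type*} [NormedAddCommGroup E] [NormedSpace ℝ E]
  {E' : Type*} [NormedAddCommGroup E'] [NormedSpace ℝ E']
  {E'' : Type*} [NormedAddCommGroup E''] [NormedSpace ℝ E'']

theorem eventually_differentiableAt {f : E' → E} {z : E'} (hf : ContDiffAt ℝ ∞ f z) :
    ∀ᶠ y in 𝓝 z, DifferentiableAt ℝ f y :=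
  ((hf.of_le (m := 1) ENat.LEInfty.out).eventually (by simp)).mono
    fun _ hy => hy.differentiableAt (by simp)

/-- The chain rule for second derivatives. -/
theorem fderiv_fderiv_comp {f : E' → E''} {h : E → E'} {z : E} (hf : ContDiffAt ℝ ∞ f (h z))
    (hh : ContDiffAt ℝ ∞ h z) (u v : E) :
    fderiv ℝ (fderiv ℝ (f ∘ h)) z u v =
      fderiv ℝ (fderiv ℝ f) (h z) (fderiv ℝ h z u) (fderiv ℝ h z v)
        + fderiv ℝ f (h z) (fderiv ℝ (fderiv ℝ h) z u v) := by
  have heq : fderiv ℝ (f ∘ h) =ᶠ[𝓝 z] fun y => (fderiv ℝ f (h y)).comp (fderiv ℝ h y) := by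
    filter_upwards [hh.continuousAt.eventually (eventually_differentiableAt hf),
      eventually_differentiableAt hh] with y h1 h2
    exact fderiv_comp y h1 h2
  have d1 : HasFDerivAt (fderiv ℝ f) (fderiv ℝ (fderiv ℝ f) (h z)) (h z) :=
    ((hf.fderiv_right (m := ∞) (by simp)).differentiableAt (by simp)).hasFDerivAt
  have d2 : HasFDerivAt (fderiv ℝ h) (fderiv ℝ (fderiv ℝ h) z) z :=
    ((hh.fderiv_right (m := ∞) (by simp)).differentiableAt (by simp)).hasFDerivAt
  have d3 : HasFDerivAt h (fderiv ℝ h z) z := (hh.differentiableAt (by simp)).hasFDerivAt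
  have d4 := (d1.comp z d3).clm_comp d2
  rw [heq.fderiv_eq]
  erw [d4.fderiv]
  simp [add_comm]

theorem IsGeodesicAt.congr {G : E → E →L[ℝ] E →L[ℝ] ℝ} {F F' : E' → E} {z : E'}
    (h : IsGeodesicAt G F z) (heq : F =ᶠ[𝓝 z] F') : IsGeodesicAt G F' z := by
  unfold IsGeodesicAt at h ⊢
  rw [← heq.fderiv.fderiv_eq, ← heq.fderiv_eq, ← heq.eq_of_nhds]
  exact h

/-- The vanishing of the second fundamental form does not depend on the parametrization. -/
theorem IsGeodesicAt.of_comp_right {G : E → E →L[ℝ] E →L[ℝ] ℝ} {F : E' → E} {φ : E'' → E'}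
    {z : E''} (h : IsGeodesicAt G (F ∘ φ) z) (hF : ContDiffAt ℝ ∞ F (φ z))
    (hφ : ContDiffAt ℝ ∞ φ z) (hs : Function.Surjective (fderiv ℝ φ z)) :
    IsGeodesicAt G F (φ z) := by
  intro u v
  obtain ⟨u, rfl⟩ := hs u
  obtain ⟨v, rfl⟩ := hs v
  obtain ⟨a, ha⟩ := h u v
  have hc := fderiv_comp z (hF.differentiableAt (by simp)) (hφ.differentiableAt (by simp))
  rw [fderiv_fderiv_comp hF hφ, hc] at ha
  refine ⟨fderiv ℝ φ z a - fderiv ℝ (fderiv ℝ φ) z u v, ?_⟩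
  simp at ha
  simp [ha]
  abel

/-- The vanishing of the second fundamental form does not depend on the chart. -/
theorem IsGeodesicAt.of_comp_left [FiniteDimensional ℝ E] [FiniteDimensional ℝ E']
    {H : E → E →L[ℝ] E →L[ℝ] ℝ}
    {G : E' → E' →L[ℝ] E' →L[ℝ] ℝ} {F : E'' → E} {ψ : E → E'} {V : Set E} {U : Set E'}
    (hψ : IsPullbackOn H G ψ V U) {z : E''} (h : IsGeodesicAt G (ψ ∘ F) z) (hz : F z ∈ V)
    (hs : Function.Surjective (fderiv ℝ ψ (F z)))
    (hF : ContDiffAt ℝ ∞ F z) :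
    IsGeodesicAt H F z := by
  intro u v
  obtain ⟨a, ha⟩ := h u v
  have hc := fderiv_comp z ((hψ.contDiffAt hz).differentiableAt (by simp))
    (hF.differentiableAt (by simp))
  rw [fderiv_fderiv_comp (hψ.contDiffAt hz) hF, hc] at ha
  refine ⟨a, hψ.injective _ hz ?_⟩
  simp at ha
  simp [ha, hψ.fderiv_christoffel hz (IsPullbackOn.isGeodesicAt_of_surjective hs)]
  abel

/-- If two metrics agree on the tangent vectors of a submanifold, and to first order on pairs of
tangent vectors, then the submanifold is totally geodesic for both or for none. -/
theorem IsGeodesicAt.of_agree [FiniteDimensional ℝ E]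
    {G G' : E → E →L[ℝ] E →L[ℝ] ℝ} {F : E' → E} {V : Set E'} {U : Set E}
    (hG : IsMetricOn G U) (hG' : IsMetricOn G' U) (hV : IsOpen V) (hF : ContDiffOn ℝ ∞ F V)
    (hmaps : MapsTo F V U) {z : E'} (hz : z ∈ V)
    (h0 : ∀ y ∈ V, ∀ a w, G (F y) (fderiv ℝ F y a) w = G' (F y) (fderiv ℝ F y a) w)
    (h1 : ∀ w a b, fderiv ℝ G (F z) w (fderiv ℝ F z a) (fderiv ℝ F z b) =
      fderiv ℝ G' (F z) w (fderiv ℝ F z a) (fderiv ℝ F z b))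
    (hgeo : IsGeodesicAt G F z) : IsGeodesicAt G' F z := by
  have hFz := hmaps hz
  have hFd : HasFDerivAt F (fderiv ℝ F z) z :=
    ((hF.contDiffAt (hV.mem_nhds hz)).differentiableAt (by simp)).hasFDerivAt
  have hFc := contDiffAt_fderiv_infty hV hF hz
  have hFd2 : HasFDerivAt (fderiv ℝ F) (fderiv ℝ (fderiv ℝ F) z) z :=
    (hFc.differentiableAt (by simp)).hasFDerivAt
  have hder : ∀ {K : E → E →L[ℝ] E →L[ℝ] ℝ}, IsMetricOn K U → ∀ u v w,
      fderiv ℝ (fun y => K (F y) (fderiv ℝ F y v) w) z u =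
        fderiv ℝ K (F z) (fderiv ℝ F z u) (fderiv ℝ F z v) w
          + K (F z) (fderiv ℝ (fderiv ℝ F) z u v) w := by
    intro K hK u v w
    have hL := ((((hK.differentiableAt hFz).hasFDerivAt.comp z hFd).clm_apply
      (hFd2.clm_apply (hasFDerivAt_const v z))).clm_apply (hasFDerivAt_const w z))
    erw [hL.fderiv]
    simp
    ring
  -- Derivatives of the form `G(dF v, ·)` along the submanifold are the same for both metrics, with
  -- `w` arbitrary.
  have hd : ∀ u v w, fderiv ℝ G (F z) (fderiv ℝ F z u) (fderiv ℝ F z v) w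
          + G (F z) (fderiv ℝ (fderiv ℝ F) z u v) w =
        fderiv ℝ G' (F z) (fderiv ℝ F z u) (fderiv ℝ F z v) w
          + G' (F z) (fderiv ℝ (fderiv ℝ F) z u v) w := by
    intro u v w
    rw [← hder hG, ← hder hG']
    have : (fun y => G (F y) (fderiv ℝ F y v) w) =ᶠ[𝓝 z] fun y => G' (F y) (fderiv ℝ F y v) w :=
      Filter.eventually_of_mem (hV.mem_nhds hz) fun y hy => h0 y hy v w
    rw [this.fderiv_eq]
  have hsymm : ∀ u v, fderiv ℝ (fderiv ℝ F) z u v = fderiv ℝ (fderiv ℝ F) z v u :=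
    fun u v => ((hF.contDiffAt (hV.mem_nhds hz)).isSymmSndFDerivAt
      (by rw [minSmoothness_of_isRCLikeNormedField]; exact ENat.LEInfty.out)).eq u v
  intro u v
  obtain ⟨a, ha⟩ := hgeo u v
  refine ⟨a, ?_⟩
  have ha' : fderiv ℝ F z a = _ := ha
  change fderiv ℝ F z a = _
  -- The same tangent vector `a` works for `G'`: both metrics lower it to the same form, and the
  -- lowered `D²F + Γ` agree by `hd` for the two tangential derivatives and by `h1` for the third.
  apply hG'.injective hFz
  intro w
  rw [← h0 z hz, ha', map_add, add_apply, hG.apply_christoffel hFz, map_add, add_apply,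
    hG'.apply_christoffel hFz, IsMetricOn.christoffelFirst_apply,
    IsMetricOn.christoffelFirst_apply, h1]
  have e1 := hd u v w
  have e2 := hd v u w
  rw [hsymm v u] at e2
  linarith

end CoordGeometry

/-! ### Totally geodesic flat submanifolds, and their persistence under the change of metric. -/

namespace ImmersedSubmanifold

open CoordGeometry

variable {E : Type*} [NormedAddCommGroup E] [NormedSpace ℝ E]
  {M : Type*} [TopologicalSpace M] [ChartedSpace E M]

/-- The parametrization of the submanifold by the inverse of the preferred chart at `y`. -/
def param (S : ImmersedSubmanifold E M) (y : S.carrier) : EuclideanSpace ℝ (Fin S.dim) → M :=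
  S.toFun ∘ (extChartAt 𝓘(ℝ, EuclideanSpace ℝ (Fin S.dim)) y).symm

/-- The part of the domain of `param` that is mapped into the preferred chart at `c`. -/
def paramDomain (S : ImmersedSubmanifold E M) (y : S.carrier) (c : M) :
    Set (EuclideanSpace ℝ (Fin S.dim)) :=
  (extChartAt 𝓘(ℝ, EuclideanSpace ℝ (Fin S.dim)) y).target ∩ S.param y ⁻¹' (chartAt E c).source

theorem localExpr_eq (S : ImmersedSubmanifold E M) (y : S.carrier) :
    S.localExpr y = extChartAt 𝓘(ℝ, E) (S.toFun y) ∘ S.param y := rfl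

theorem contMDiffOn_param (S : ImmersedSubmanifold E M) (y : S.carrier) :
    ContMDiffOn 𝓘(ℝ, EuclideanSpace ℝ (Fin S.dim)) 𝓘(ℝ, E) ∞ (S.param y)
      (extChartAt 𝓘(ℝ, EuclideanSpace ℝ (Fin S.dim)) y).target :=
  S.contMDiff.comp_contMDiffOn (contMDiffOn_extChartAt_symm y)

theorem isOpen_paramDomain (S : ImmersedSubmanifold E M) (y : S.carrier) (c : M) :
    IsOpen (S.paramDomain y c) :=
  (S.contMDiffOn_param y).continuousOn.isOpen_inter_preimage (isOpen_extChartAt_target y)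
    (chartAt E c).open_source

theorem mem_paramDomain (S : ImmersedSubmanifold E M) (y : S.carrier) :
    extChartAt 𝓘(ℝ, EuclideanSpace ℝ (Fin S.dim)) y y ∈ S.paramDomain y (S.toFun y) := by
  refine ⟨mem_extChartAt_target y, ?_⟩
  simp only [param, mem_preimage, Function.comp, extChartAt_to_inv]
  exact mem_chart_source E _

theorem mfderiv_param (S : ImmersedSubmanifold E M) (y : S.carrier)
    {z : EuclideanSpace ℝ (Fin S.dim)}
    (hz : z ∈ (extChartAt 𝓘(ℝ, EuclideanSpace ℝ (Fin S.dim)) y).target) :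
    mfderiv 𝓘(ℝ, EuclideanSpace ℝ (Fin S.dim)) 𝓘(ℝ, E) (S.param y) z =
      (mfderiv 𝓘(ℝ, EuclideanSpace ℝ (Fin S.dim)) 𝓘(ℝ, E) S.toFun
        ((extChartAt 𝓘(ℝ, EuclideanSpace ℝ (Fin S.dim)) y).symm z)).comp
      (mfderiv 𝓘(ℝ, EuclideanSpace ℝ (Fin S.dim)) 𝓘(ℝ, EuclideanSpace ℝ (Fin S.dim))
        (extChartAt 𝓘(ℝ, EuclideanSpace ℝ (Fin S.dim)) y).symm z) :=
  mfderiv_comp z (S.contMDiff.mdifferentiableAt (by simp)) (mdifferentiableAt_extChartAt_symm' hz)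

variable [IsManifold 𝓘(ℝ, E) ∞ M] [FiniteDimensional ℝ E]

theorem isPullbackOn (S : ImmersedSubmanifold E M) (g : SmoothMetric E M) (y : S.carrier) (c : M) :
    IsPullbackOn (metricCoeff (S.inducedMetric g.inner) y) (metricCoeff g.inner c)
      (extChartAt 𝓘(ℝ, E) c ∘ S.param y) (S.paramDomain y c) (extChartAt 𝓘(ℝ, E) c).target := by
  refine isPullbackOn_extChartAt_comp g c (S.isOpen_paramDomain y c)
    ((S.contMDiffOn_param y).mono inter_subset_left) (fun z hz => hz.2) ?_ ?_
  · intro z hz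
    rw [S.mfderiv_param y hz.1]
    exact (S.immersion _).comp
      (injective_of_isInvertible (isInvertible_mfderiv_extChartAt_symm hz.1))
  · intro z hz
    unfold pullbackField
    rw [S.mfderiv_param y hz.1]
    rfl

/-- Being totally geodesic can be checked in any charts. -/
theorem IsTotallyGeodesic.isGeodesicAt {S : ImmersedSubmanifold E M} {g : SmoothMetric E M}
    (h : S.IsTotallyGeodesic g.inner) (y : S.carrier) (c : M)
    {z : EuclideanSpace ℝ (Fin S.dim)} (hz : z ∈ S.paramDomain y c) :
    IsGeodesicAt (metricCoeff g.inner c) (extChartAt 𝓘(ℝ, E) c ∘ S.param y) z := by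
  set I := 𝓘(ℝ, EuclideanSpace ℝ (Fin S.dim))
  -- The hypothesis only speaks of preferred charts at their centres. At a general `z` one passes to
  -- the charts centred at `y₁` and at its image, with transition maps `φ` and `ψ`.
  set y₁ := (extChartAt I y).symm z with hy₁
  set z₁ := extChartAt I y₁ y₁ with hz₁
  have hy₁s : y₁ ∈ (chartAt (EuclideanSpace ℝ (Fin S.dim)) y).source := by
    rw [← extChartAt_source I]; exact (extChartAt I y).map_target hz.1
  have hy₁s' : y₁ ∈ (extChartAt I y).source := (extChartAt I y).map_target hz.1
  have hgeo : IsGeodesicAt (metricCoeff g.inner (S.toFun y₁)) (S.localExpr y₁) z₁ := by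
    intro u v
    have h2 := h y₁ u v
    have h3 : S.localExpr y₁ z₁ = extChartAt 𝓘(ℝ, E) (S.toFun y₁) (S.toFun y₁) := by
      simp [localExpr, hz₁, Function.comp, I]
    simp only at h2
    rw [← h3] at h2
    exact h2
  set φ := extChartAt I y ∘ (extChartAt I y₁).symm with hφ
  set ψ := extChartAt 𝓘(ℝ, E) (S.toFun y₁) ∘ (extChartAt 𝓘(ℝ, E) c).symm with hψ
  have hsymm : (extChartAt I y₁).symm z₁ = y₁ := extChartAt_to_inv y₁
  have hφz : φ z₁ = z := by
    simp only [hφ, Function.comp, hsymm]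
    exact (extChartAt I y).right_inv hz.1
  have hz₁t : z₁ ∈ (extChartAt I y₁).target := mem_extChartAt_target y₁
  have hφc : ContDiffAt ℝ ∞ φ z₁ := by
    rw [← contMDiffAt_iff_contDiffAt]
    refine ContMDiffAt.comp z₁ (contMDiffAt_extChartAt' (by rw [hsymm]; exact hy₁s)) ?_
    exact (contMDiffOn_extChartAt_symm y₁).contMDiffAt
      ((isOpen_extChartAt_target y₁).mem_nhds hz₁t)
  have hφs : Function.Surjective (fderiv ℝ φ z₁) :=
    (bijective_fderiv_chart_change y₁ y hz₁t (by rw [hsymm]; exact hy₁s)).2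
  have hzc : S.toFun y₁ ∈ (chartAt E c).source := hz.2
  have hzc' : S.toFun y₁ ∈ (extChartAt 𝓘(ℝ, E) c).source := by rw [extChartAt_source]; exact hzc
  have heq : S.localExpr y₁ =ᶠ[𝓝 z₁] (ψ ∘ (extChartAt 𝓘(ℝ, E) c ∘ S.param y)) ∘ φ := by
    have hcont : ContinuousAt (extChartAt I y₁).symm z₁ :=
      (continuousOn_extChartAt_symm y₁).continuousAt ((isOpen_extChartAt_target y₁).mem_nhds hz₁t)
    have e1 : ∀ᶠ x in 𝓝 z₁, (extChartAt I y₁).symm x ∈ (extChartAt I y).source :=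
      hcont.eventually ((isOpen_extChartAt_source y).mem_nhds (by rw [hsymm]; exact hy₁s'))
    have e2 : ∀ᶠ x in 𝓝 z₁, S.toFun ((extChartAt I y₁).symm x) ∈ (extChartAt 𝓘(ℝ, E) c).source :=
      (S.contMDiff.continuous.continuousAt.comp hcont).eventually
        ((isOpen_extChartAt_source c).mem_nhds
          (by simp only [Function.comp]; rw [hsymm]; exact hzc'))
    filter_upwards [e1, e2] with x h1 h2
    simp only [hφ, hψ, localExpr, param, Function.comp]
    rw [(extChartAt I y).left_inv h1, (extChartAt 𝓘(ℝ, E) c).left_inv h2]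
  have hgeo2 := hgeo.congr heq
  have hP := S.isPullbackOn g y c
  have hFz : ContDiffAt ℝ ∞ (extChartAt 𝓘(ℝ, E) c ∘ S.param y) z := hP.contDiffAt hz
  have hsymmc : (extChartAt 𝓘(ℝ, E) c).symm ((extChartAt 𝓘(ℝ, E) c ∘ S.param y) z) =
      S.toFun y₁ := (extChartAt 𝓘(ℝ, E) c).left_inv hzc'
  have hQ := isPullbackOn_chart_change g c (S.toFun y₁)
  have hmem : (extChartAt 𝓘(ℝ, E) c ∘ S.param y) z ∈ (extChartAt 𝓘(ℝ, E) c).target ∩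
      (extChartAt 𝓘(ℝ, E) c).symm ⁻¹' (chartAt E (S.toFun y₁)).source := by
    refine ⟨hP.mapsTo hz, ?_⟩
    rw [mem_preimage, hsymmc]
    exact mem_chart_source E _
  have hgeo3 : IsGeodesicAt (metricCoeff g.inner (S.toFun y₁))
      (ψ ∘ (extChartAt 𝓘(ℝ, E) c ∘ S.param y)) z := by
    rw [← hφz]
    refine hgeo2.of_comp_right ?_ hφc hφs
    rw [hφz]
    exact (hQ.contDiffAt hmem).comp z hFz
  exact hgeo3.of_comp_left hQ hmem
    (bijective_fderiv_chart_change c (S.toFun y₁) hmem.1 hmem.2).2 hFz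

omit [FiniteDimensional ℝ E] in
theorem vecCoord_mfderiv (S : ImmersedSubmanifold E M) (y : S.carrier)
    (u : TangentSpace 𝓘(ℝ, EuclideanSpace ℝ (Fin S.dim)) y) :
    vecCoord (S.toFun y) (mfderiv 𝓘(ℝ, EuclideanSpace ℝ (Fin S.dim)) 𝓘(ℝ, E) S.toFun y u) =
      fderiv ℝ (S.localExpr y) (extChartAt 𝓘(ℝ, EuclideanSpace ℝ (Fin S.dim)) y y)
        (vecCoord y u) := by
  revert u
  set I := 𝓘(ℝ, EuclideanSpace ℝ (Fin S.dim))
  intro u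
  have h1 : MDifferentiableAt I 𝓘(ℝ, E) S.toFun y := S.contMDiff.mdifferentiableAt (by simp)
  have h2 := mdifferentiableAt_extChartAt_of_mem (mem_chart_source E (S.toFun y))
  have h3 : MDifferentiableAt I I (extChartAt I y) y :=
    mdifferentiableAt_extChartAt_of_mem (mem_chart_source _ y)
  have h4 : MDifferentiableAt I 𝓘(ℝ, E) (S.localExpr y) (extChartAt I y y) := by
    have h5 := S.contMDiffOn_param y |>.contMDiffAt
      ((isOpen_extChartAt_target y).mem_nhds (mem_extChartAt_target y))
    have h6 : S.param y (extChartAt I y y) = S.toFun y := by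
      simp [param, Function.comp, I]
    have h7 : MDifferentiableAt 𝓘(ℝ, E) 𝓘(ℝ, E) (extChartAt 𝓘(ℝ, E) (S.toFun y))
        (S.param y (extChartAt I y y)) := by
      rw [h6]; exact h2
    exact MDifferentiableAt.comp _ h7 (h5.mdifferentiableAt (by simp))
  have heq : extChartAt 𝓘(ℝ, E) (S.toFun y) ∘ S.toFun =ᶠ[𝓝 y] S.localExpr y ∘ extChartAt I y :=
    Filter.eventually_of_mem ((isOpen_extChartAt_source y).mem_nhds (mem_extChartAt_source y))
      fun x hx => by
        simp only [localExpr, Function.comp]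
        rw [(extChartAt I y).left_inv hx]
  have e := heq.mfderiv_eq (I := I) (I' := 𝓘(ℝ, E))
  rw [mfderiv_comp y h2 h1, mfderiv_comp y h4 h3, mfderiv_eq_fderiv] at e
  exact congrArg (fun T : EuclideanSpace ℝ (Fin S.dim) →L[ℝ] E => T u) e

omit [FiniteDimensional ℝ E] in
theorem exists_vecCoord_eq (c : M) (a : E) :
    ∃ X : TangentSpace 𝓘(ℝ, E) c, vecCoord c X = a := by
  have := isManifold_one E M
  exact surjective_of_isInvertible
    (isInvertible_mfderiv_extChartAt (I := 𝓘(ℝ, E)) (mem_extChartAt_source c)) a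

/-- The curvature of the ambient manifold vanishes on vectors tangent to a totally geodesic flat
submanifold. -/
theorem riemann_eq_zero {S : ImmersedSubmanifold E M} {g : SmoothMetric E M}
    (hgeod : S.IsTotallyGeodesic g.inner) (hflat : S.IsFlat g.inner) (y : S.carrier)
    {X Y Z : TangentSpace 𝓘(ℝ, E) (S.toFun y)} (hX : X ∈ S.tangent y) (hY : Y ∈ S.tangent y)
    (hZ : Z ∈ S.tangent y) (W : TangentSpace 𝓘(ℝ, E) (S.toFun y)) :
    riemann g.inner (S.toFun y) X Y Z W = 0 := by
  set I := 𝓘(ℝ, EuclideanSpace ℝ (Fin S.dim))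
  obtain ⟨u, rfl⟩ := hX
  obtain ⟨v, rfl⟩ := hY
  obtain ⟨w, rfl⟩ := hZ
  have hP := S.isPullbackOn g y (S.toFun y)
  have hz := S.mem_paramDomain y
  -- Intrinsic flatness kills the curvature vector of the induced metric. As `S` is totally
  -- geodesic, its image is the full ambient vector `R(X, Y)Z`, normal part included, so `W` may be
  -- any vector.
  have h0 : curvatureOp (metricCoeff (S.inducedMetric g.inner) y) (extChartAt I y y)
      (vecCoord y u) (vecCoord y v) (vecCoord y w) = 0 := by
    apply hP.isMetricOn.injective hz
    intro b
    obtain ⟨x, rfl⟩ := exists_vecCoord_eq y b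
    rw [map_zero]
    exact hflat y u v w x
  have h1 := hP.curvatureOp (fun z hz => hgeod.isGeodesicAt y (S.toFun y) hz) hz
    (vecCoord y u) (vecCoord y v) (vecCoord y w)
  rw [h0, map_zero] at h1
  have h3 : (extChartAt 𝓘(ℝ, E) (S.toFun y) ∘ S.param y) (extChartAt I y y) =
      extChartAt 𝓘(ℝ, E) (S.toFun y) (S.toFun y) := by
    simp [param, Function.comp, I]
  rw [h3] at h1
  unfold riemann curvatureTensor
  have e := S.vecCoord_mfderiv y
  change metricCoeff g.inner _ _ (curvatureOp _ _
    (vecCoord (S.toFun y) (mfderiv I 𝓘(ℝ, E) S.toFun y u))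
    (vecCoord (S.toFun y) (mfderiv I 𝓘(ℝ, E) S.toFun y v))
    (vecCoord (S.toFun y) (mfderiv I 𝓘(ℝ, E) S.toFun y w))) _ = 0
  rw [e, e, e, localExpr_eq, ← h1]
  simp

omit [IsManifold 𝓘(ℝ, E) ∞ M] [FiniteDimensional ℝ E] in
theorem AgreeOn.inducedMetric_eq {S : ImmersedSubmanifold E M}
    {g g' : ∀ x : M, TangentSpace 𝓘(ℝ, E) x →L[ℝ] TangentSpace 𝓘(ℝ, E) x →L[ℝ] ℝ}
    (h : S.AgreeOn g g') : S.inducedMetric g = S.inducedMetric g' := by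
  funext y
  ext u v
  exact h y _ ⟨u, rfl⟩ _

omit [IsManifold 𝓘(ℝ, E) ∞ M] [FiniteDimensional ℝ E] in
theorem IsFlat.of_agree {S : ImmersedSubmanifold E M}
    {g g' : ∀ x : M, TangentSpace 𝓘(ℝ, E) x →L[ℝ] TangentSpace 𝓘(ℝ, E) x →L[ℝ] ℝ}
    (hflat : S.IsFlat g) (h : S.AgreeOn g g') : S.IsFlat g' := by
  unfold IsFlat at hflat ⊢
  rw [← h.inducedMetric_eq]
  exact hflat

omit [FiniteDimensional ℝ E] in
theorem mfderiv_symm_mfderiv {c q : M} (hq : q ∈ (chartAt E c).source)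
    (X : TangentSpace 𝓘(ℝ, E) q) :
    (mfderiv 𝓘(ℝ, E) 𝓘(ℝ, E) (extChartAt 𝓘(ℝ, E) c).symm (extChartAt 𝓘(ℝ, E) c q)
      (mfderiv 𝓘(ℝ, E) 𝓘(ℝ, E) (extChartAt 𝓘(ℝ, E) c) q X) : E) = X := by
  have hq' : q ∈ (extChartAt 𝓘(ℝ, E) c).source := by rw [extChartAt_source]; exact hq
  have heq : (extChartAt 𝓘(ℝ, E) c).symm ∘ extChartAt 𝓘(ℝ, E) c =ᶠ[𝓝 q] id :=
    Filter.eventually_of_mem ((isOpen_extChartAt_source (I := 𝓘(ℝ, E)) c).mem_nhds hq')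
      fun y hy => (extChartAt 𝓘(ℝ, E) c).left_inv hy
  have e := heq.mfderiv_eq (I := 𝓘(ℝ, E)) (I' := 𝓘(ℝ, E))
  rw [mfderiv_comp q (mdifferentiableAt_extChartAt_symm'
    ((extChartAt 𝓘(ℝ, E) c).map_source hq')) (mdifferentiableAt_extChartAt_of_mem hq),
    mfderiv_id] at e
  exact congrArg (fun T : E →L[ℝ] E => T X) e

omit [FiniteDimensional ℝ E] in
theorem metricCoeff_mfderiv
    (g : ∀ x : M, TangentSpace 𝓘(ℝ, E) x →L[ℝ] TangentSpace 𝓘(ℝ, E) x →L[ℝ] ℝ)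
    {c q : M} (hq : q ∈ (chartAt E c).source)
    (X : TangentSpace 𝓘(ℝ, E) q) (w : E) :
    metricCoeff g c (extChartAt 𝓘(ℝ, E) c q)
      (mfderiv 𝓘(ℝ, E) 𝓘(ℝ, E) (extChartAt 𝓘(ℝ, E) c) q X) w =
      g q X (mfderiv 𝓘(ℝ, E) 𝓘(ℝ, E) (extChartAt 𝓘(ℝ, E) c).symm
        (extChartAt 𝓘(ℝ, E) c q) w : E) := by
  have hq' : q ∈ (extChartAt 𝓘(ℝ, E) c).source := by rw [extChartAt_source]; exact hq
  have h1 := mfderiv_symm_mfderiv hq X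
  refine (form_congr g ((extChartAt 𝓘(ℝ, E) c).left_inv hq') _ _).trans ?_
  exact congrArg (fun a : E => g q a (mfderiv 𝓘(ℝ, E) 𝓘(ℝ, E) (extChartAt 𝓘(ℝ, E) c).symm
        (extChartAt 𝓘(ℝ, E) c q) w : E)) h1

/-- If two metrics agree along `S`, and to first order on vectors tangent to `S`, and `S` is totally
geodesic for one of them then so it is for the other. -/
theorem IsTotallyGeodesic.of_agree {S : ImmersedSubmanifold E M} {g g' : SmoothMetric E M}
    (hgeod : S.IsTotallyGeodesic g.inner) (h0 : S.AgreeOn g.inner g'.inner)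
    (h1 : S.AgreeToFirstOrderOn g.inner g'.inner) : S.IsTotallyGeodesic g'.inner := by
  intro y
  set I := 𝓘(ℝ, EuclideanSpace ℝ (Fin S.dim))
  have hP := S.isPullbackOn g y (S.toFun y)
  have hz := S.mem_paramDomain y
  have h3 : (extChartAt 𝓘(ℝ, E) (S.toFun y) ∘ S.param y) (extChartAt I y y) =
      extChartAt 𝓘(ℝ, E) (S.toFun y) (S.toFun y) := by
    simp [param, Function.comp, I]
  have hres : IsGeodesicAt (metricCoeff g'.inner (S.toFun y))
      (extChartAt 𝓘(ℝ, E) (S.toFun y) ∘ S.param y) (extChartAt I y y) := by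
    refine IsGeodesicAt.of_agree hP.metric (isMetricOn_metricCoeff g' _) hP.isOpen hP.contDiffOn
      hP.mapsTo hz ?_ ?_ (hgeod.isGeodesicAt y (S.toFun y) hz)
    -- Agreement along `S` is needed on a whole neighbourhood, because it gets differentiated.
    · intro x hx a w
      have hd : (fderiv ℝ (extChartAt 𝓘(ℝ, E) (S.toFun y) ∘ S.param y) x a : E) =
          mfderiv 𝓘(ℝ, E) 𝓘(ℝ, E) (extChartAt 𝓘(ℝ, E) (S.toFun y)) (S.param y x)
            (mfderiv I 𝓘(ℝ, E) S.toFun ((extChartAt I y).symm x)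
              (mfderiv I I (extChartAt I y).symm x a)) := by
        have e := mfderiv_comp (I := I) (I' := 𝓘(ℝ, E)) (I'' := 𝓘(ℝ, E)) x
          (mdifferentiableAt_extChartAt_of_mem hx.2)
          (((S.contMDiffOn_param y).contMDiffAt
            ((isOpen_extChartAt_target y).mem_nhds hx.1)).mdifferentiableAt (by simp))
        rw [mfderiv_eq_fderiv, S.mfderiv_param y hx.1] at e
        exact congrArg (fun T : EuclideanSpace ℝ (Fin S.dim) →L[ℝ] E => T a) e
      rw [hd]
      refine (metricCoeff_mfderiv g.inner hx.2 _ w).trans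
        (Eq.trans ?_ (metricCoeff_mfderiv g'.inner hx.2 _ w).symm)
      exact h0 ((extChartAt I y).symm x) _ ⟨_, rfl⟩ _
    -- The first-order condition is needed only at the centre of the preferred charts, where it is
    -- stated.
    · intro w a b
      obtain ⟨u, rfl⟩ := exists_vecCoord_eq y a
      obtain ⟨v, rfl⟩ := exists_vecCoord_eq y b
      have e := S.vecCoord_mfderiv y
      rw [localExpr_eq] at e
      rw [h3, ← e, ← e]
      exact h1 y _ ⟨u, rfl⟩ _ ⟨v, rfl⟩ w
  intro u v
  have h4 := hres u v
  rw [h3] at h4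
  exact h4

end ImmersedSubmanifold

theorem Filter.Tendsto.clm_apply {F F' : Type*} [NormedAddCommGroup F] [NormedSpace ℝ F]
    [NormedAddCommGroup F'] [NormedSpace ℝ F'] {ι : Type*} {l : Filter ι} {A : ι → F →L[ℝ] F'}
    {x : ι → F} {A₀ : F →L[ℝ] F'} {x₀ : F} (hA : Filter.Tendsto A l (𝓝 A₀))
    (hx : Filter.Tendsto x l (𝓝 x₀)) : Filter.Tendsto (fun i => A i (x i)) l (𝓝 (A₀ x₀)) :=
  ((isBoundedBilinearMap_apply (𝕜 := ℝ) (E := F) (F := F')).continuous.tendsto (A₀, x₀)).comp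
    (hA.prodMk_nhds hx)

/-! ### Continuity of the curvature in the metric, for the `C²` topology. -/

section C2

open CoordGeometry Filter

attribute [local instance] c2Topology

variable {E : Type*} [NormedAddCommGroup E] [NormedSpace ℝ E]
  {M : Type*} [TopologicalSpace M] [ChartedSpace E M] [IsManifold 𝓘(ℝ, E) ∞ M]

theorem isOpen_c2Ball (g : SmoothMetric E M) (c : M) {K : Set E} {δ : ℝ} (hK : IsCompact K)
    (hKt : K ⊆ (extChartAt 𝓘(ℝ, E) c).target) (hδ : 0 < δ) : IsOpen (c2Ball g c K δ) :=
  TopologicalSpace.isOpen_generateFrom_of_mem ⟨g, c, K, δ, hK, hKt, hδ, rfl⟩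

theorem mem_c2Ball_self (g : SmoothMetric E M) (c : M) (K : Set E) {δ : ℝ} (hδ : 0 < δ) :
    g ∈ c2Ball g c K δ := by
  intro z _ k _
  have : (fun y => metricCoeff g.inner c y - metricCoeff g.inner c y) = fun _ => 0 := by
    funext y; exact sub_self _
  rw [this]
  simp [iteratedFDeriv_fun_zero, hδ]

variable [FiniteDimensional ℝ E]

/-- A compact neighbourhood `K` of `z` inside the chart gives one `c2Ball` valid for all points near
`z`, hence a joint neighbourhood. -/
theorem eventually_norm_iteratedFDeriv_lt (g : SmoothMetric E M) (c : M) {z : E}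
    (hz : z ∈ (extChartAt 𝓘(ℝ, E) c).target) {δ : ℝ} (hδ : 0 < δ) :
    ∀ᶠ q : SmoothMetric E M × E in 𝓝 (g, z), q.2 ∈ (extChartAt 𝓘(ℝ, E) c).target ∧
      ∀ k ≤ 2, ‖iteratedFDeriv ℝ k
        (fun y => metricCoeff q.1.inner c y - metricCoeff g.inner c y) q.2‖ < δ := by
  have : ProperSpace E := FiniteDimensional.proper ℝ E
  obtain ⟨K, hK, hzK, hKt⟩ := exists_compact_subset (isOpen_extChartAt_target c) hz
  rw [nhds_prod_eq]
  have h1 : ∀ᶠ g' in 𝓝 g, g' ∈ c2Ball g c K δ :=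
    (isOpen_c2Ball g c hK hKt hδ).mem_nhds (mem_c2Ball_self g c K hδ)
  have h2 : ∀ᶠ x in 𝓝 z, x ∈ K := mem_interior_iff_mem_nhds.1 hzK
  filter_upwards [h1.prod_mk h2] with q hq
  exact ⟨hKt hq.2, fun k hk => hq.1 q.2 hq.2 k hk⟩

section Jet

variable {ι : Type*} {l : Filter ι} {γ : ι → SmoothMetric E M} {ζ : ι → E}
  {g : SmoothMetric E M} {c : M} {z : E}

/-- Below, `A` is a jet of `γ i` and `B` the same jet of the fixed `g`, both at the moving point `ζ
i`: the `C²` topology bounds the difference and smoothness of `g` handles `B`. -/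
theorem tendsto_of_norm_sub_lt {F : Type*} [NormedAddCommGroup F] {A B : ι → F} {a : F}
    (hB : Tendsto B l (𝓝 a)) (h : ∀ δ : ℝ, 0 < δ → ∀ᶠ i in l, ‖A i - B i‖ < δ) :
    Tendsto A l (𝓝 a) := by
  have h0 : Tendsto (fun i => A i - B i) l (𝓝 0) := by
    rw [Metric.tendsto_nhds]
    intro δ hδ
    filter_upwards [h δ hδ] with i hi
    simpa using hi
  simpa using h0.add hB

theorem tendsto_metricCoeff (hγ : Tendsto γ l (𝓝 g)) (hζ : Tendsto ζ l (𝓝 z))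
    (hz : z ∈ (extChartAt 𝓘(ℝ, E) c).target) :
    Tendsto (fun i => metricCoeff (γ i).inner c (ζ i)) l (𝓝 (metricCoeff g.inner c z)) := by
  refine tendsto_of_norm_sub_lt
    (((isMetricOn_metricCoeff g c).contDiffAt hz).continuousAt.tendsto.comp hζ) fun δ hδ => ?_
  filter_upwards [(hγ.prodMk_nhds hζ).eventually (eventually_norm_iteratedFDeriv_lt g c hz hδ)]
    with i hi
  simpa using hi.2 0 (by norm_num)

theorem tendsto_fderiv_metricCoeff (hγ : Tendsto γ l (𝓝 g)) (hζ : Tendsto ζ l (𝓝 z))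
    (hz : z ∈ (extChartAt 𝓘(ℝ, E) c).target) :
    Tendsto (fun i => fderiv ℝ (metricCoeff (γ i).inner c) (ζ i)) l
      (𝓝 (fderiv ℝ (metricCoeff g.inner c) z)) := by
  refine tendsto_of_norm_sub_lt
    (((isMetricOn_metricCoeff g c).contDiffAt_fderiv hz).continuousAt.tendsto.comp hζ)
    fun δ hδ => ?_
  filter_upwards [(hγ.prodMk_nhds hζ).eventually (eventually_norm_iteratedFDeriv_lt g c hz hδ)]
    with i hi
  have h1 := hi.2 1 (by norm_num)
  rw [norm_iteratedFDeriv_one, fderiv_fun_sub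
    ((isMetricOn_metricCoeff (γ i) c).differentiableAt hi.1)
    ((isMetricOn_metricCoeff g c).differentiableAt hi.1)] at h1
  exact h1

theorem tendsto_fderiv_fderiv_metricCoeff (hγ : Tendsto γ l (𝓝 g)) (hζ : Tendsto ζ l (𝓝 z))
    (hz : z ∈ (extChartAt 𝓘(ℝ, E) c).target) :
    Tendsto (fun i => fderiv ℝ (fderiv ℝ (metricCoeff (γ i).inner c)) (ζ i)) l
      (𝓝 (fderiv ℝ (fderiv ℝ (metricCoeff g.inner c)) z)) := by
  refine tendsto_of_norm_sub_lt
    ((((isMetricOn_metricCoeff g c).contDiffAt_fderiv hz).fderiv_right (m := ∞)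
      (by simp)).continuousAt.tendsto.comp hζ) fun δ hδ => ?_
  filter_upwards [(hγ.prodMk_nhds hζ).eventually (eventually_norm_iteratedFDeriv_lt g c hz hδ)]
    with i hi
  have h1 := hi.2 2 le_rfl
  have heq : fderiv ℝ (fun y => metricCoeff (γ i).inner c y - metricCoeff g.inner c y)
      =ᶠ[𝓝 (ζ i)] fun y => fderiv ℝ (metricCoeff (γ i).inner c) y
        - fderiv ℝ (metricCoeff g.inner c) y :=
    eventually_of_mem ((isOpen_extChartAt_target c).mem_nhds hi.1) fun y hy =>
      fderiv_fun_sub ((isMetricOn_metricCoeff (γ i) c).differentiableAt hy)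
        ((isMetricOn_metricCoeff g c).differentiableAt hy)
  rw [← norm_iteratedFDeriv_fderiv (n := 1), norm_iteratedFDeriv_one, heq.fderiv_eq,
    fderiv_fun_sub ((isMetricOn_metricCoeff (γ i) c).differentiableAt_fderiv hi.1)
    ((isMetricOn_metricCoeff g c).differentiableAt_fderiv hi.1)] at h1
  exact h1

theorem tendsto_christoffel_metricCoeff (hγ : Tendsto γ l (𝓝 g)) (hζ : Tendsto ζ l (𝓝 z))
    (hz : z ∈ (extChartAt 𝓘(ℝ, E) c).target) {u v : ι → E} {u₀ v₀ : E}
    (hu : Tendsto u l (𝓝 u₀)) (hv : Tendsto v l (𝓝 v₀)) :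
    Tendsto (fun i => christoffel (metricCoeff (γ i).inner c) (ζ i) (u i) (v i)) l
      (𝓝 (christoffel (metricCoeff g.inner c) z u₀ v₀)) := by
  have h0 := tendsto_metricCoeff hγ hζ hz
  have h1 := tendsto_fderiv_metricCoeff hγ hζ hz
  obtain ⟨e, he⟩ := exists_equiv_of_pos _ ((isMetricOn_metricCoeff g c).pos z hz)
  have h2 : Tendsto (fun i => (metricCoeff (γ i).inner c (ζ i)).inverse) l
      (𝓝 (metricCoeff g.inner c z).inverse) := by
    have h3 := (contDiffAt_map_inverse (n := ∞) e).continuousAt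
    rw [he] at h3
    exact h3.tendsto.comp h0
  have h4 := ((ContinuousLinearMap.flipₗᵢ ℝ E E (E →L[ℝ] ℝ)).continuous.tendsto _).comp h1
  have h5 := ((ContinuousLinearMap.flipₗᵢ ℝ E E ℝ).continuous.tendsto _).comp (h4.clm_apply hu)
  exact h2.clm_apply (((((h1.clm_apply hu).clm_apply hv).add ((h1.clm_apply hv).clm_apply hu)).sub
    (h5.clm_apply hv)).const_smul (1 / 2 : ℝ))

/-- The curvature tensor depends continuously on the metric in the `C²` topology, on the point and
on the vectors. -/
theorem tendsto_curvatureTensor_metricCoeff (hγ : Tendsto γ l (𝓝 g)) (hζ : Tendsto ζ l (𝓝 z))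
    (hz : z ∈ (extChartAt 𝓘(ℝ, E) c).target) {u v w x : ι → E} {u₀ v₀ w₀ x₀ : E}
    (hu : Tendsto u l (𝓝 u₀)) (hv : Tendsto v l (𝓝 v₀))
    (hw : Tendsto w l (𝓝 w₀)) (hx : Tendsto x l (𝓝 x₀)) :
    Tendsto (fun i => curvatureTensor (metricCoeff (γ i).inner c) (ζ i) (u i) (v i) (w i) (x i)) l
      (𝓝 (curvatureTensor (metricCoeff g.inner c) z u₀ v₀ w₀ x₀)) := by
  have h0 := tendsto_metricCoeff hγ hζ hz
  have h2 := tendsto_fderiv_fderiv_metricCoeff hγ hζ hz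
  rw [(isMetricOn_metricCoeff g c).curvatureTensor_eq hz]
  have hmem : ∀ᶠ i in l, ζ i ∈ (extChartAt 𝓘(ℝ, E) c).target :=
    hζ.eventually ((isOpen_extChartAt_target c).mem_nhds hz)
  -- The two-jet formula contains no derivative of `Γ`, so convergence of two derivatives of the
  -- metric suffices.
  have heq : (fun i => curvatureTensor (metricCoeff (γ i).inner c) (ζ i) (u i) (v i) (w i) (x i))
      =ᶠ[l] _ := hmem.mono fun i hi => (isMetricOn_metricCoeff (γ i) c).curvatureTensor_eq hi _ _ _ _
  rw [tendsto_congr' heq]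
  have d : ∀ {a b a' b' : ι → E} {a₀ b₀ a₀' b₀' : E}, Tendsto a l (𝓝 a₀) → Tendsto b l (𝓝 b₀) →
      Tendsto a' l (𝓝 a₀') → Tendsto b' l (𝓝 b₀') →
      Tendsto (fun i => fderiv ℝ (fderiv ℝ (metricCoeff (γ i).inner c)) (ζ i)
        (a i) (b i) (a' i) (b' i)) l
      (𝓝 (fderiv ℝ (fderiv ℝ (metricCoeff g.inner c)) z a₀ b₀ a₀' b₀')) :=
    fun ha hb ha' hb' => (((h2.clm_apply ha).clm_apply hb).clm_apply ha').clm_apply hb'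
  have t : ∀ {a b : ι → E} {a₀ b₀ : E}, Tendsto a l (𝓝 a₀) → Tendsto b l (𝓝 b₀) → _ :=
    fun ha hb => tendsto_christoffel_metricCoeff (c := c) hγ hζ hz ha hb
  exact ((((((d hu hw hv hx).add (d hv hx hu hw)).sub (d hu hx hv hw)).sub
    (d hv hw hu hx)).div_const 2).add ((h0.clm_apply (t hv hx)).clm_apply (t hu hw))).sub
    ((h0.clm_apply (t hu hx)).clm_apply (t hv hw))

end Jet

end C2

/-! ### Algebraic curvature tensors -/

/-- Functions with the linearity and the symmetries of a curvature tensor (the first Bianchi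
identity is not included). -/
structure IsAlgCurvature {V : Type*} [AddCommGroup V] [Module ℝ V] (R : V → V → V → V → ℝ) :
    Prop where
  add_left : ∀ u u' v w x, R (u + u') v w x = R u v w x + R u' v w x
  smul_left : ∀ (t : ℝ) u v w x, R (t • u) v w x = t * R u v w x
  antisymm : ∀ u v w x, R u v w x = - R v u w x
  pair_symm : ∀ u v w x, R u v w x = R w x u v

/-- The coefficient of `r ^ 2` in `curv (X + r σ Z, W + r τ V)`, with the terms of higher order
included. -/
def pencilRemainder {α : Type*} (R : α → α → α → α → ℝ) (X W Z V : α) (σ τ r : ℝ) : ℝ :=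
  σ ^ 2 * R Z W W Z + 2 * σ * τ * (R X W V Z + R X V W Z) + τ ^ 2 * R X V V X
    + r * (2 * σ ^ 2 * τ * R Z V W Z + 2 * σ * τ ^ 2 * R X V V Z)
    + r ^ 2 * (σ ^ 2 * τ ^ 2 * R Z V V Z)

namespace IsAlgCurvature

variable {V : Type*} [AddCommGroup V] [Module ℝ V] {R : V → V → V → V → ℝ}

theorem add₂ (h : IsAlgCurvature R) (u v v' w x : V) :
    R u (v + v') w x = R u v w x + R u v' w x := by
  rw [h.antisymm, h.add_left, h.antisymm u v, h.antisymm u v']; ring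

theorem smul₂ (h : IsAlgCurvature R) (t : ℝ) (u v w x : V) :
    R u (t • v) w x = t * R u v w x := by
  rw [h.antisymm, h.smul_left, h.antisymm u v]; ring

theorem add₃ (h : IsAlgCurvature R) (u v w w' x : V) :
    R u v (w + w') x = R u v w x + R u v w' x := by
  rw [h.pair_symm, h.add_left, ← h.pair_symm, ← h.pair_symm u v w']

theorem smul₃ (h : IsAlgCurvature R) (t : ℝ) (u v w x : V) :
    R u v (t • w) x = t * R u v w x := by
  rw [h.pair_symm, h.smul_left, ← h.pair_symm]

theorem add₄ (h : IsAlgCurvature R) (u v w x x' : V) :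
    R u v w (x + x') = R u v w x + R u v w x' := by
  rw [h.pair_symm, h.add₂, ← h.pair_symm, ← h.pair_symm u v w x']

theorem smul₄ (h : IsAlgCurvature R) (t : ℝ) (u v w x : V) :
    R u v w (t • x) = t * R u v w x := by
  rw [h.pair_symm, h.smul₂, ← h.pair_symm]

theorem antisymm_right (h : IsAlgCurvature R) (u v w x : V) : R u v w x = - R u v x w := by
  rw [h.pair_symm, h.antisymm, h.pair_symm x w]

theorem self_left (h : IsAlgCurvature R) (u w x : V) : R u u w x = 0 := by
  have := h.antisymm u u w x
  linarith

theorem self_right (h : IsAlgCurvature R) (u v w : V) : R u v w w = 0 := by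
  rw [h.pair_symm, h.self_left]

/-- The quadratic form of a plane in another basis. -/
theorem quadratic_basis_change (h : IsAlgCurvature R) (A B : V) (a b c d : ℝ) :
    R (a • A + b • B) (c • A + d • B) (c • A + d • B) (a • A + b • B) =
      (a * d - b * c) ^ 2 * R A B B A := by
  simp only [h.add_left, h.add₂, h.add₃, h.add₄, h.smul_left, h.smul₂, h.smul₃, h.smul₄,
    h.self_left, h.self_right]
  rw [h.antisymm_right A B A B, h.antisymm B A B A, h.antisymm B A A B, h.antisymm_right A B A B]
  ring

/-- The constant and linear terms are kept apart: they involve only the mixed curvatures that vanish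
on planes tangent to flat totally geodesic submanifolds. -/
theorem quadratic_pencil (h : IsAlgCurvature R) (X W Z V : V) (σ τ r : ℝ) :
    R (X + (r * σ) • Z) (W + (r * τ) • V) (W + (r * τ) • V) (X + (r * σ) • Z) =
      R X W W X + 2 * (r * σ) * R X W W Z + 2 * (r * τ) * R W X X V
        + r ^ 2 * pencilRemainder R X W Z V σ τ r := by
  unfold pencilRemainder
  -- Reversal of the four arguments identifies the mirror-image terms of the expansion.
  have sw : ∀ a b c d, R a b c d = R d c b a := fun a b c d => by
    rw [h.pair_symm, h.antisymm, h.antisymm_right, neg_neg]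
  simp only [h.add_left, h.add₂, h.add₃, h.add₄, h.smul_left, h.smul₂, h.smul₃, h.smul₄]
  rw [sw Z W W X, sw Z V V X, sw Z W V X, sw Z V W X, sw Z W V Z, h.antisymm X V W X,
    h.antisymm_right V X W X, h.pair_symm V X X W, h.antisymm_right X W V X,
    h.antisymm X W X V]
  ring

end IsAlgCurvature

/-! ### Curvature on the tangent bundle, and uniform positivity of the pencils. -/

section Curvature

open CoordGeometry Filter Bundle

variable {E : Type*} [NormedAddCommGroup E] [NormedSpace ℝ E] [FiniteDimensional ℝ E]

theorem CoordGeometry.IsMetricOn.isAlgCurvature {G : E → E →L[ℝ] E →L[ℝ] ℝ} {U : Set E}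
    (h : IsMetricOn G U) {z : E} (hz : z ∈ U) : IsAlgCurvature (curvatureTensor G z) where
  add_left u u' v w x := by
    simp only [h.curvatureTensor_eq hz, ← christoffelL_apply, map_add, add_apply]
    ring
  smul_left t u v w x := by
    simp only [h.curvatureTensor_eq hz, ← christoffelL_apply, map_smul, smul_apply, smul_eq_mul]
    ring
  antisymm := IsMetricOn.curvatureTensor_antisymm G z
  pair_symm := h.curvatureTensor_pair_symm hz

variable {M : Type*} [TopologicalSpace M] [ChartedSpace E M] [IsManifold 𝓘(ℝ, E) ∞ M]

theorem isAlgCurvature_riemann (g : SmoothMetric E M) (p : M) :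
    IsAlgCurvature (riemann g.inner p) := by
  have h := (isMetricOn_metricCoeff g p).isAlgCurvature (mem_extChartAt_target p)
  refine ⟨fun u u' v w x => ?_, fun t u v w x => ?_, fun u v w x => ?_, fun u v w x => ?_⟩
  · unfold riemann
    rw [← h.add_left]
    congr 1
    exact map_add (mfderiv 𝓘(ℝ, E) 𝓘(ℝ, E) (extChartAt 𝓘(ℝ, E) p) p) u u'
  · unfold riemann
    rw [← h.smul_left]
    congr 1
    exact map_smul (mfderiv 𝓘(ℝ, E) 𝓘(ℝ, E) (extChartAt 𝓘(ℝ, E) p) p) t u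
  · exact h.antisymm _ _ _ _
  · exact h.pair_symm _ _ _ _

-- Links coordinate expressions to the topology of the tangent bundle, whence their continuity.
omit [FiniteDimensional ℝ E] in
theorem vecCoordAt_eq_trivializationAt (c : M) {q : TangentBundle 𝓘(ℝ, E) M}
    (hq : q.proj ∈ (chartAt E c).source) :
    vecCoordAt c q.proj q.2 = (trivializationAt E (TangentSpace 𝓘(ℝ, E)) c q).2 := by
  have := isManifold_one E M
  have h1 := TangentBundle.continuousLinearMapAt_trivializationAt (I := 𝓘(ℝ, E)) hq
  have hb : q.proj ∈ (trivializationAt E (TangentSpace 𝓘(ℝ, E) : M → Type _) c).baseSet := hq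
  have h2 := Trivialization.coe_linearMapAt_of_mem (R := ℝ)
    (trivializationAt E (TangentSpace 𝓘(ℝ, E) : M → Type _) c) hb
  have h3 := congrFun h2 q.2
  rw [← h3]
  unfold vecCoordAt
  rw [← h1]
  rfl

omit [FiniteDimensional ℝ E] in
theorem continuousAt_vecCoordAt (c : M) {q : TangentBundle 𝓘(ℝ, E) M}
    (hq : q.proj ∈ (chartAt E c).source) :
    ContinuousAt (fun q : TangentBundle 𝓘(ℝ, E) M => vecCoordAt c q.proj q.2) q := by
  have := isManifold_one E M
  set e := trivializationAt E (TangentSpace 𝓘(ℝ, E) : M → Type _) c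
  have hs : q ∈ e.source := (e.mem_source).2 hq
  have h1 : ContinuousAt (fun q => (e q).2) q :=
    continuousAt_snd.comp (e.continuousAt hs)
  refine h1.congr (eventually_of_mem (e.open_source.mem_nhds hs) fun x hx => ?_)
  exact (vecCoordAt_eq_trivializationAt c ((e.mem_source).1 hx)).symm

/-- The curvature tensor in the chart at `c`, as a function of tangent vectors; it is meaningful for
vectors with the same foot point. -/
def riemannAt (g : SmoothMetric E M) (c : M) (X Y Z W : TangentBundle 𝓘(ℝ, E) M) : ℝ :=
  curvatureTensor (metricCoeff g.inner c) (extChartAt 𝓘(ℝ, E) c X.proj)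
    (vecCoordAt c X.proj X.2) (vecCoordAt c Y.proj Y.2) (vecCoordAt c Z.proj Z.2)
    (vecCoordAt c W.proj W.2)

theorem riemann_eq_riemannAt (g : SmoothMetric E M) (c : M) {p : M}
    (hp : p ∈ (chartAt E c).source) (X Y Z W : TangentSpace 𝓘(ℝ, E) p) :
    riemann g.inner p X Y Z W = riemannAt g c ⟨p, X⟩ ⟨p, Y⟩ ⟨p, Z⟩ ⟨p, W⟩ :=
  riemann_eq_curvatureTensor g c hp X Y Z W

attribute [local instance] c2Topology

/-- One chart, at the limit foot point, serves for the whole family; no common foot point is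
required along the filter. -/
theorem tendsto_riemannAt {ι : Type*} {l : Filter ι} {γ : ι → SmoothMetric E M}
    {g : SmoothMetric E M} (hγ : Tendsto γ l (𝓝 g)) {c : M}
    {X Y Z W : ι → TangentBundle 𝓘(ℝ, E) M} {X₀ Y₀ Z₀ W₀ : TangentSpace 𝓘(ℝ, E) c}
    (hX : Tendsto X l (𝓝 ⟨c, X₀⟩)) (hY : Tendsto Y l (𝓝 ⟨c, Y₀⟩)) (hZ : Tendsto Z l (𝓝 ⟨c, Z₀⟩))
    (hW : Tendsto W l (𝓝 ⟨c, W₀⟩)) :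
    Tendsto (fun i => riemannAt (γ i) c (X i) (Y i) (Z i) (W i)) l
      (𝓝 (riemann g.inner c X₀ Y₀ Z₀ W₀)) := by
  have hc := mem_chart_source E c
  have hv : ∀ {A : ι → TangentBundle 𝓘(ℝ, E) M} {A₀ : TangentSpace 𝓘(ℝ, E) c},
      Tendsto A l (𝓝 ⟨c, A₀⟩) →
      Tendsto (fun i => vecCoordAt c (A i).proj (A i).2) l (𝓝 (vecCoordAt c c A₀)) :=
    fun {A A₀} hA => (continuousAt_vecCoordAt c (q := ⟨c, A₀⟩) hc).tendsto.comp hA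
  have hp : Tendsto (fun i => extChartAt 𝓘(ℝ, E) c (X i).proj) l (𝓝 (extChartAt 𝓘(ℝ, E) c c)) :=
    (continuousAt_extChartAt c).tendsto.comp
      (((FiberBundle.continuous_proj E (TangentSpace 𝓘(ℝ, E) : M → Type _)).tendsto
        (⟨c, X₀⟩ : TangentBundle 𝓘(ℝ, E) M)).comp hX)
  exact tendsto_curvatureTensor_metricCoeff hγ hp (mem_extChartAt_target c) (hv hX) (hv hY) (hv hZ)
    (hv hW)

/-- Near the quadruples of a compact set with positive quadratic terms, the pencils are positive for
all metrics near `g`. -/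
theorem eventually_pencilRemainder_pos (g : SmoothMetric E M)
    {Q : Set (TangentBundle 𝓘(ℝ, E) M × TangentBundle 𝓘(ℝ, E) M ×
        TangentBundle 𝓘(ℝ, E) M × TangentBundle 𝓘(ℝ, E) M)} (hQ : IsCompact Q)
    (hpos : ∀ q ∈ Q, ∃ (p : M) (X W Z V : TangentSpace 𝓘(ℝ, E) p),
      q = (⟨p, X⟩, ⟨p, W⟩, ⟨p, Z⟩, ⟨p, V⟩) ∧
      ∀ σ τ : ℝ, σ ^ 2 + τ ^ 2 = 1 → 0 < quadraticTerm g.inner p X W Z V σ τ) :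
    ∀ᶠ x : SmoothMetric E M × ℝ in 𝓝 (g, 0), ∀ (p : M) (X W Z V : TangentSpace 𝓘(ℝ, E) p),
      ((⟨p, X⟩, ⟨p, W⟩, ⟨p, Z⟩, ⟨p, V⟩) : TangentBundle 𝓘(ℝ, E) M × TangentBundle 𝓘(ℝ, E) M ×
        TangentBundle 𝓘(ℝ, E) M × TangentBundle 𝓘(ℝ, E) M) ∈ Q →
      ∀ σ τ : ℝ, σ ^ 2 + τ ^ 2 = 1 →
        0 < pencilRemainder (riemann x.1.inner p) X W Z V σ τ x.2 := by
  have hcirc : IsCompact {s : ℝ × ℝ | s.1 ^ 2 + s.2 ^ 2 = 1} := by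
    refine (isCompact_Icc.prod isCompact_Icc).of_isClosed_subset
      (s := Icc (-1 : ℝ) 1 ×ˢ Icc (-1 : ℝ) 1) ?_ ?_
    · exact isClosed_eq (by fun_prop) continuous_const
    · rintro ⟨s, t⟩ h
      simp only [mem_ofPred_eq] at h
      refine ⟨⟨?_, ?_⟩, ⟨?_, ?_⟩⟩ <;> simp only <;> nlinarith [sq_nonneg s, sq_nonneg t]
  -- Compactness of `Q` times the circle makes the neighbourhood of `(g, 0)` uniform. The local
  -- statement also covers quadruples outside `Q`, and is vacuous if their foot points differ.
  have key := (hQ.prod hcirc).eventually_forall_of_forall_eventually (x₀ := (g, (0 : ℝ)))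
    (P := fun x k => ∀ (p : M) (X W Z V : TangentSpace 𝓘(ℝ, E) p),
      k.1 = (⟨p, X⟩, ⟨p, W⟩, ⟨p, Z⟩, ⟨p, V⟩) →
        0 < pencilRemainder (riemann x.1.inner p) X W Z V k.2.1 k.2.2 x.2) ?_
  · filter_upwards [key] with x hx p X W Z V hmem σ τ hst
    exact hx (_, (σ, τ)) ⟨hmem, hst⟩ p X W Z V rfl
  · rintro ⟨q, σ, τ⟩ ⟨hq, hst⟩
    obtain ⟨c, X, W, Z, V, rfl, hp⟩ := hpos q hq
    set l := 𝓝 (((g, (0 : ℝ)), (((⟨c, X⟩, ⟨c, W⟩, ⟨c, Z⟩, ⟨c, V⟩), (σ, τ)) :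
      (TangentBundle 𝓘(ℝ, E) M × TangentBundle 𝓘(ℝ, E) M ×
        TangentBundle 𝓘(ℝ, E) M × TangentBundle 𝓘(ℝ, E) M) × ℝ × ℝ))) with hl
    have hid := tendsto_id (x := l)
    rw [hl] at hid
    have hg := (continuous_fst.comp continuous_fst).continuousAt.tendsto.comp hid
    have hr := (continuous_snd.comp continuous_fst).continuousAt.tendsto.comp hid
    have hk := continuous_snd.continuousAt.tendsto.comp hid
    have hX := (continuous_fst.comp continuous_fst).continuousAt.tendsto.comp hk
    have hW := (continuous_fst.comp (continuous_snd.comp continuous_fst)).continuousAt.tendsto.comp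
      hk
    have hZ := (continuous_fst.comp (continuous_snd.comp (continuous_snd.comp
      continuous_fst))).continuousAt.tendsto.comp hk
    have hV := (continuous_snd.comp (continuous_snd.comp (continuous_snd.comp
      continuous_fst))).continuousAt.tendsto.comp hk
    have hs := (continuous_fst.comp continuous_snd).continuousAt.tendsto.comp hk
    have ht := (continuous_snd.comp continuous_snd).continuousAt.tendsto.comp hk
    simp only [Function.comp_def, id] at hg hr hX hW hZ hV hs ht
    have lim := ((((hs.pow 2).mul (tendsto_riemannAt hg hZ hW hW hZ)).add
      (((hs.const_mul 2).mul ht).mul ((tendsto_riemannAt hg hX hW hV hZ).add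
        (tendsto_riemannAt hg hX hV hW hZ)))).add
      ((ht.pow 2).mul (tendsto_riemannAt hg hX hV hV hX))).add
      (hr.mul ((((hs.pow 2).const_mul 2).mul ht |>.mul (tendsto_riemannAt hg hZ hV hW hZ)).add
        (((hs.const_mul 2).mul (ht.pow 2)).mul (tendsto_riemannAt hg hX hV hV hZ)))) |>.add
      ((hr.pow 2).mul (((hs.pow 2).mul (ht.pow 2)).mul (tendsto_riemannAt hg hZ hV hV hZ)))
    -- At `r = 0` the remainder is exactly the quadratic term of `g`.
    have hpos' := lim.eventually_const_lt (u := 0) (by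
      have h1 := hp σ τ hst
      unfold quadraticTerm curv at h1
      simpa using h1)
    have hsrc := hX.eventually ((FiberBundle.continuous_proj E
      (TangentSpace 𝓘(ℝ, E) : M → Type _)).continuousAt.eventually
        ((chartAt E c).open_source.mem_nhds (mem_chart_source E c)))
    filter_upwards [hpos', hsrc] with y hy hys p X' W' Z' V' hk'
    rw [hk'] at hy hys
    unfold pencilRemainder
    simp only [riemann_eq_riemannAt y.1.1 c hys]
    exact hy

end Curvature

/-! ### Bases of planes normalized to a compact set. -/

section Frames

/-- Gram–Schmidt, recorded as a triangular change of basis. -/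
theorem exists_orthonormal_of_linearIndependent {F : Type*} [NormedAddCommGroup F]
    [InnerProductSpace ℝ F] {a b : F} (h : LinearIndependent ℝ ![a, b]) :
    ∃ (x y : F) (α γ δ : ℝ), ‖x‖ = 1 ∧ ‖y‖ = 1 ∧ inner ℝ x y = 0 ∧ α ≠ 0 ∧ δ ≠ 0 ∧
      a = α • x ∧ b = γ • x + δ • y := by
  rw [LinearIndependent.pair_iff] at h
  have ha : a ≠ 0 := by
    rintro rfl
    simpa using (h 1 0 (by simp)).1
  have hα : ‖a‖ ≠ 0 := norm_ne_zero_iff.2 ha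
  set x := ‖a‖⁻¹ • a with hx
  have hx1 : ‖x‖ = 1 := by simp [hx, norm_smul, hα]
  set y' := b - (inner ℝ x b : ℝ) • x with hy'
  have hy0 : y' ≠ 0 := by
    intro h0
    have h1 := h (-(inner ℝ x b * ‖a‖⁻¹)) 1 (by
      rw [hy', hx, smul_smul] at h0
      rw [neg_smul, one_smul, neg_add_eq_sub]
      exact h0)
    exact one_ne_zero h1.2
  have hδ : ‖y'‖ ≠ 0 := norm_ne_zero_iff.2 hy0
  refine ⟨x, ‖y'‖⁻¹ • y', ‖a‖, inner ℝ x b, ‖y'‖, hx1, by simp [norm_smul, hδ], ?_, hα, hδ, ?_, ?_⟩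
  · rw [inner_smul_right, hy', inner_sub_right, inner_smul_right, real_inner_self_eq_norm_sq, hx1]
    simp
  · rw [hx, smul_smul, mul_inv_cancel₀ hα, one_smul]
  · rw [smul_inv_smul₀ hδ, hy']
    abel

theorem linearIndependent_pair_of_eq {V : Type*} [AddCommGroup V] [Module ℝ V] {A B A' B' : V}
    {α γ δ : ℝ} (hα : α ≠ 0) (hδ : δ ≠ 0) (hA : A = α • A') (hB : B = γ • A' + δ • B')
    (h : LinearIndependent ℝ ![A, B]) : LinearIndependent ℝ ![A', B'] := by
  rw [LinearIndependent.pair_iff] at h ⊢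
  intro s t hst
  have h1 := h (s * α⁻¹ - t * δ⁻¹ * γ * α⁻¹) (t * δ⁻¹) (by
    rw [hA, hB, smul_add, smul_smul, smul_smul, smul_smul]
    have e1 : (s * α⁻¹ - t * δ⁻¹ * γ * α⁻¹) * α = s - t * δ⁻¹ * γ := by field_simp
    have e2 : t * δ⁻¹ * δ = t := by field_simp
    rw [e1, e2, ← add_assoc, ← add_smul, sub_add_cancel, hst])
  have ht : t = 0 := by simpa [hδ] using h1.2
  have hs := h1.1
  rw [ht] at hs
  exact ⟨by simpa [hα] using hs, ht⟩

variable {E : Type*} [NormedAddCommGroup E] [NormedSpace ℝ E] [FiniteDimensional ℝ E]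

/-- A compact set of bases of planes in a finite-dimensional space. -/
def frames (E : Type*) [NormedAddCommGroup E] [NormedSpace ℝ E] [FiniteDimensional ℝ E] :
    Set (E × E) :=
  {e | ‖toEuclidean e.1‖ = 1 ∧ ‖toEuclidean e.2‖ = 1 ∧
    inner ℝ (toEuclidean e.1) (toEuclidean e.2) = 0}

theorem isCompact_frames : IsCompact (frames E) := by
  set T := (toEuclidean : E ≃L[ℝ] _)
  have h1 : IsCompact ((fun e : _ × _ => (T.symm e.1, T.symm e.2)) ''
      (Metric.sphere (0 : EuclideanSpace ℝ (Fin (Module.finrank ℝ E))) 1 ×ˢ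
        Metric.sphere (0 : EuclideanSpace ℝ (Fin (Module.finrank ℝ E))) 1)) :=
    ((isCompact_sphere _ _).prod (isCompact_sphere _ _)).image (by fun_prop)
  refine h1.of_isClosed_subset ?_ ?_
  · have hc := T.continuous
    refine (isClosed_eq (by fun_prop) continuous_const).inter
      ((isClosed_eq (by fun_prop) continuous_const).inter
        (isClosed_eq (Continuous.inner (by fun_prop) (by fun_prop)) continuous_const))
  · rintro ⟨a, b⟩ ⟨ha, hb, -⟩
    exact ⟨(T a, T b), ⟨by simpa using ha, by simpa using hb⟩, by simp⟩

/-- `E` is only normed, so orthonormality is taken in the auxiliary Euclidean structure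
`toEuclidean`. -/
theorem exists_mem_frames {a b : E} (h : LinearIndependent ℝ ![a, b]) :
    ∃ e ∈ frames E, ∃ α γ δ : ℝ, α ≠ 0 ∧ δ ≠ 0 ∧ a = α • e.1 ∧ b = γ • e.1 + δ • e.2 := by
  set T := (toEuclidean : E ≃L[ℝ] _)
  have h' : LinearIndependent ℝ ![T a, T b] := by
    rw [LinearIndependent.pair_iff] at h ⊢
    intro s t hst
    refine h s t (T.injective ?_)
    rw [map_add, map_smul, map_smul, hst, map_zero]
  obtain ⟨x, y, α, γ, δ, hx, hy, hxy, hα, hδ, ha, hb⟩ := exists_orthonormal_of_linearIndependent h'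
  refine ⟨(T.symm x, T.symm y), ⟨by simp [T, hx], by simp [T, hy], by simp [T, hxy]⟩, α, γ, δ, hα,
    hδ, T.injective (by simp [ha]), T.injective (by simp [hb])⟩

theorem linearIndependent_of_mem_frames {e : E × E} (h : e ∈ frames E) :
    LinearIndependent ℝ ![e.1, e.2] := by
  set T := (toEuclidean : E ≃L[ℝ] _)
  rw [LinearIndependent.pair_iff]
  intro s t hst
  obtain ⟨h1, h2, h3⟩ := h
  have hT : s • T e.1 + t • T e.2 = 0 := by rw [← map_smul, ← map_smul, ← map_add, hst, map_zero]
  have i1 := congrArg (fun w => inner ℝ (T e.1) w) hT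
  have i2 := congrArg (fun w => inner ℝ (T e.2) w) hT
  simp only [inner_add_right, inner_smul_right, real_inner_self_eq_norm_sq, inner_zero_right] at i1 i2
  rw [real_inner_comm] at i2
  rw [h1, h3] at i1
  rw [h2, h3] at i2
  exact ⟨by simpa using i1, by simpa using i2⟩

end Frames

/-! ### Positive curvature away from the zero planes. -/

section Away

open CoordGeometry Filter Bundle

attribute [local instance] c2Topology

variable {E : Type*} [NormedAddCommGroup E] [NormedSpace ℝ E]
  {M : Type*} [TopologicalSpace M] [ChartedSpace E M] [IsManifold 𝓘(ℝ, E) ∞ M]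

theorem injective_vecCoordAt {c p : M} (hp : p ∈ (chartAt E c).source) :
    Function.Injective (vecCoordAt (E := E) c p) := by
  have := isManifold_one E M
  exact injective_of_isInvertible
    (isInvertible_mfderiv_extChartAt (I := 𝓘(ℝ, E)) (by rwa [extChartAt_source]))

/-- The tangent vector at `p` with coordinate expression `a` in the chart at `c`. -/
def ofCoordAt (c p : M) (a : E) : TangentSpace 𝓘(ℝ, E) p :=
  (trivializationAt E (TangentSpace 𝓘(ℝ, E) : M → Type _) c).symm p a

theorem vecCoordAt_ofCoordAt {c p : M} (hp : p ∈ (chartAt E c).source) (a : E) :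
    vecCoordAt c p (ofCoordAt c p a) = a := by
  have h := vecCoordAt_eq_trivializationAt c (q := ⟨p, ofCoordAt c p a⟩) hp
  rw [h]
  have hb : p ∈ (trivializationAt E (TangentSpace 𝓘(ℝ, E) : M → Type _) c).baseSet := hp
  unfold ofCoordAt
  rw [(trivializationAt E (TangentSpace 𝓘(ℝ, E) : M → Type _) c).apply_mk_symm hb]

theorem continuousAt_ofCoordAt (c : M) (a : E) :
    ContinuousAt (fun x : M × E => (⟨x.1, ofCoordAt c x.1 x.2⟩ : TangentBundle 𝓘(ℝ, E) M))
      (c, a) := by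
  set e := trivializationAt E (TangentSpace 𝓘(ℝ, E) : M → Type _) c
  have hs : (c, a) ∈ e.target := (e.mem_target).2 (mem_chart_source E c)
  have h1 : ContinuousAt e.toOpenPartialHomeomorph.symm (c, a) :=
    e.toOpenPartialHomeomorph.symm.continuousAt hs
  refine h1.congr (eventually_of_mem (e.open_target.mem_nhds hs) fun x hx => ?_)
  exact (e.mk_symm ((e.mem_target).1 hx) x.2).symm

variable [FiniteDimensional ℝ E]

/-- If `g` is nonnegatively curved, then, for metrics near `g`, planes away from the zero planes of
`g` have positive curvature. -/
theorem eventually_mem_or_curv_pos [CompactSpace M] (g : SmoothMetric E M)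
    (hnonneg : ∀ p : M, NonnegCurvedAt g.inner p)
    {U : Set (TangentBundle 𝓘(ℝ, E) M × TangentBundle 𝓘(ℝ, E) M)} (hU : IsOpen U)
    (hzero : ∀ (p : M) (X W : TangentSpace 𝓘(ℝ, E) p), IsZeroPlane g.inner p X W →
      ((⟨p, X⟩, ⟨p, W⟩) : TangentBundle 𝓘(ℝ, E) M × TangentBundle 𝓘(ℝ, E) M) ∈ U) :
    ∀ᶠ g' in 𝓝 g, ∀ (p : M) (A B : TangentSpace 𝓘(ℝ, E) p), LinearIndependent ℝ ![A, B] →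
      ∃ (A' B' : TangentSpace 𝓘(ℝ, E) p) (α γ δ : ℝ), α ≠ 0 ∧ δ ≠ 0 ∧ A = α • A' ∧
        B = γ • A' + δ • B' ∧
        (((⟨p, A'⟩, ⟨p, B'⟩) : TangentBundle 𝓘(ℝ, E) M × TangentBundle 𝓘(ℝ, E) M) ∈ U ∨
          0 < curv g'.inner p A' B') := by
  -- Bases of planes form a noncompact set and `U` need not be invariant under change of basis,
  -- hence the passage to a normalized basis `A'`, `B'`. Compactness is used twice: for `M` here,
  -- and for `frames E` in a chart.
  have key := isCompact_univ.eventually_forall_of_forall_eventually (x₀ := g)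
    (P := fun (g' : SmoothMetric E M) (p : M) => ∀ (A B : TangentSpace 𝓘(ℝ, E) p),
      LinearIndependent ℝ ![A, B] →
      ∃ (A' B' : TangentSpace 𝓘(ℝ, E) p) (α γ δ : ℝ), α ≠ 0 ∧ δ ≠ 0 ∧ A = α • A' ∧
        B = γ • A' + δ • B' ∧
        (((⟨p, A'⟩, ⟨p, B'⟩) : TangentBundle 𝓘(ℝ, E) M × TangentBundle 𝓘(ℝ, E) M) ∈ U ∨
          0 < curv g'.inner p A' B')) ?_
  · filter_upwards [key] with g' h p
    exact h p (mem_univ p)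
  intro c _
  have hframe := (isCompact_frames (E := E)).eventually_forall_of_forall_eventually (x₀ := (g, c))
    (P := fun (x : SmoothMetric E M × M) e => x.2 ∈ (chartAt E c).source →
        (((⟨x.2, ofCoordAt c x.2 e.1⟩, ⟨x.2, ofCoordAt c x.2 e.2⟩) :
          TangentBundle 𝓘(ℝ, E) M × TangentBundle 𝓘(ℝ, E) M) ∈ U ∨
          0 < curv x.1.inner x.2 (ofCoordAt c x.2 e.1) (ofCoordAt c x.2 e.2))) ?_
  · have hsrc : ∀ᶠ x : SmoothMetric E M × M in 𝓝 (g, c), x.2 ∈ (chartAt E c).source :=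
      continuousAt_snd.eventually ((chartAt E c).open_source.mem_nhds (mem_chart_source E c))
    filter_upwards [hframe, hsrc] with x hx hs A B hAB
    have hinj := injective_vecCoordAt hs
    have hadd : ∀ X Y : TangentSpace 𝓘(ℝ, E) x.2,
        vecCoordAt c x.2 (X + Y) = vecCoordAt c x.2 X + vecCoordAt c x.2 Y := fun X Y =>
      map_add (mfderiv 𝓘(ℝ, E) 𝓘(ℝ, E) (extChartAt 𝓘(ℝ, E) c) x.2) X Y
    have hsmul : ∀ (t : ℝ) (X : TangentSpace 𝓘(ℝ, E) x.2),
        vecCoordAt c x.2 (t • X) = t • vecCoordAt c x.2 X := fun t X =>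
      map_smul (mfderiv 𝓘(ℝ, E) 𝓘(ℝ, E) (extChartAt 𝓘(ℝ, E) c) x.2) t X
    have hli : LinearIndependent ℝ ![vecCoordAt c x.2 A, vecCoordAt c x.2 B] := by
      rw [LinearIndependent.pair_iff] at hAB ⊢
      intro s t hst
      refine hAB s t (hinj ?_)
      rw [hadd, hsmul, hsmul, hst]
      exact (map_zero (mfderiv 𝓘(ℝ, E) 𝓘(ℝ, E) (extChartAt 𝓘(ℝ, E) c) x.2)).symm
    obtain ⟨e, he, α, γ, δ, hα, hδ, ha, hb⟩ := exists_mem_frames hli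
    refine ⟨ofCoordAt c x.2 e.1, ofCoordAt c x.2 e.2, α, γ, δ, hα, hδ, hinj ?_, hinj ?_,
      hx e he hs⟩
    · rw [hsmul, vecCoordAt_ofCoordAt hs, ha]
    · rw [hadd, hsmul, hsmul, vecCoordAt_ofCoordAt hs, vecCoordAt_ofCoordAt hs, hb]
  · rintro ⟨a, b⟩ he
    have hcs := mem_chart_source E c
    set l := 𝓝 ((g, c), (a, b)) with hl
    have hid := tendsto_id (x := l)
    rw [hl] at hid
    have hg := (continuous_fst.comp continuous_fst).continuousAt.tendsto.comp hid
    have hA := (continuousAt_ofCoordAt c a).tendsto.comp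
      ((((continuous_snd.comp continuous_fst).prodMk
        (continuous_fst.comp continuous_snd)).tendsto ((g, c), (a, b))).comp hid)
    have hB := (continuousAt_ofCoordAt c b).tendsto.comp
      ((((continuous_snd.comp continuous_fst).prodMk
        (continuous_snd.comp continuous_snd)).tendsto ((g, c), (a, b))).comp hid)
    simp only [Function.comp_def, id] at hg hA hB
    -- Either the pair is in `U`, which is open, or it spans no zero plane and so has positive
    -- `g`-curvature; both alternatives persist nearby.
    by_cases hmem : ((⟨c, ofCoordAt c c a⟩, ⟨c, ofCoordAt c c b⟩) :
        TangentBundle 𝓘(ℝ, E) M × TangentBundle 𝓘(ℝ, E) M) ∈ U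
    · filter_upwards [(hA.prodMk_nhds hB).eventually (hU.mem_nhds hmem)] with y hy _
      exact Or.inl hy
    · have hpos : 0 < riemann g.inner c (ofCoordAt c c a) (ofCoordAt c c b) (ofCoordAt c c b)
          (ofCoordAt c c a) := by
        refine lt_of_le_of_ne (hnonneg c _ _) fun h0 => hmem (hzero c _ _ ⟨?_, h0.symm⟩)
        have hli := linearIndependent_of_mem_frames he
        rw [LinearIndependent.pair_iff] at hli ⊢
        intro s t hst
        refine hli s t ?_
        have h1 := congrArg (mfderiv 𝓘(ℝ, E) 𝓘(ℝ, E) (extChartAt 𝓘(ℝ, E) c) c) hst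
        rw [map_add, map_smul, map_smul, map_zero] at h1
        rw [← vecCoordAt_ofCoordAt hcs a, ← vecCoordAt_ofCoordAt hcs b]
        exact h1
      filter_upwards [(tendsto_riemannAt hg hA hB hB hA).eventually_const_lt hpos] with y hy hys
      right
      unfold curv
      rw [riemann_eq_riemannAt y.1.1 c hys]
      exact hy

end Away

/-! ### Change of basis, positivity along a pencil, and the theorem. -/

section Main

open CoordGeometry Filter Bundle

variable {E : Type*} [NormedAddCommGroup E] [NormedSpace ℝ E] [FiniteDimensional ℝ E]
  {M : Type*} [TopologicalSpace M] [ChartedSpace E M] [IsManifold 𝓘(ℝ, E) ∞ M]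

/-- The mixed curvatures of a plane tangent to a totally geodesic flat submanifold vanish. -/
theorem ImmersedSubmanifold.ContainsPlane.riemann_eq_zero {S : ImmersedSubmanifold E M}
    {g : SmoothMetric E M} (hgeod : S.IsTotallyGeodesic g.inner) (hflat : S.IsFlat g.inner)
    {p : M} {X W : TangentSpace 𝓘(ℝ, E) p} (h : S.ContainsPlane p X W)
    (Z : TangentSpace 𝓘(ℝ, E) p) :
    riemann g.inner p X W W Z = 0 ∧ riemann g.inner p W X X Z = 0 := by
  obtain ⟨y, u, v, hu, hv⟩ := h
  obtain rfl : S.toFun y = p := congrArg TotalSpace.proj hu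
  have hX : X ∈ S.tangent y := ⟨u, TotalSpace.mk_inj.1 hu⟩
  have hW : W ∈ S.tangent y := ⟨v, TotalSpace.mk_inj.1 hv⟩
  exact ⟨S.riemann_eq_zero hgeod hflat y hX hW hW Z, S.riemann_eq_zero hgeod hflat y hW hX hX Z⟩

/-- The tangent spaces of a totally geodesic flat submanifold of dimension at least two contain
zero planes. -/
theorem ImmersedSubmanifold.exists_isZeroPlane {S : ImmersedSubmanifold E M}
    {g : SmoothMetric E M} (hgeod : S.IsTotallyGeodesic g.inner) (hflat : S.IsFlat g.inner)
    (hdim : 2 ≤ S.dim) (y : S.carrier) :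
    ∃ X W : TangentSpace 𝓘(ℝ, E) (S.toFun y), IsZeroPlane g.inner (S.toFun y) X W := by
  set T := mfderiv 𝓘(ℝ, EuclideanSpace ℝ (Fin S.dim)) 𝓘(ℝ, E) S.toFun y
  set e₀ : EuclideanSpace ℝ (Fin S.dim) := EuclideanSpace.single ⟨0, by omega⟩ 1
  set e₁ : EuclideanSpace ℝ (Fin S.dim) := EuclideanSpace.single ⟨1, by omega⟩ 1
  have hli : ∀ s t : ℝ, s • e₀ + t • e₁ = 0 → s = 0 ∧ t = 0 := by
    intro s t hst
    have h0 := congrArg (fun w : EuclideanSpace ℝ (Fin S.dim) => w ⟨0, by omega⟩) hst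
    have h1 := congrArg (fun w : EuclideanSpace ℝ (Fin S.dim) => w ⟨1, by omega⟩) hst
    simp [e₀, e₁] at h0 h1
    exact ⟨h0, h1⟩
  refine ⟨T e₀, T e₁, ?_, S.riemann_eq_zero hgeod hflat y ⟨e₀, rfl⟩ ⟨e₁, rfl⟩ ⟨e₁, rfl⟩ _⟩
  rw [LinearIndependent.pair_iff]
  intro s t hst
  refine hli s t (S.immersion y ?_)
  have h1 : T (s • e₀ + t • e₁) = s • T e₀ + t • T e₁ :=
    (T.map_add _ _).trans (congrArg₂ (· + ·) (T.map_smul s e₀) (T.map_smul t e₁))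
  exact (h1.trans hst).trans (map_zero T).symm

theorem curv_basis_change (g : SmoothMetric E M) {p : M} {A B C D : TangentSpace 𝓘(ℝ, E) p}
    {a b c d : ℝ} (hA : A = a • C + b • D) (hB : B = c • C + d • D) :
    curv g.inner p A B = (a * d - b * c) ^ 2 * curv g.inner p C D := by
  subst hA hB
  exact (isAlgCurvature_riemann g p).quadratic_basis_change C D a b c d

/-- A dependent pair comes from a change of basis with determinant zero. -/
theorem curv_eq_zero_of_not_linearIndependent (g : SmoothMetric E M) {p : M}
    {A B : TangentSpace 𝓘(ℝ, E) p} (h : ¬ LinearIndependent ℝ ![A, B]) :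
    curv g.inner p A B = 0 := by
  rw [LinearIndependent.pair_iff] at h
  push Not at h
  obtain ⟨s, t, hst, hne⟩ := h
  by_cases hs : s = 0
  · have ht := hne hs
    rw [hs, zero_smul, zero_add] at hst
    have hB : B = 0 := (smul_eq_zero.1 hst).resolve_left ht
    rw [curv_basis_change g (C := A) (D := A) (a := 1) (b := 0) (c := 0) (d := 0) (by simp)
      (by simp [hB])]
    ring
  · have hA : A = (-(s⁻¹ * t)) • B := by
      rw [← smul_right_injective _ hs |>.eq_iff]
      simp only [smul_smul]
      rw [show s * -(s⁻¹ * t) = -t by field_simp, neg_smul]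
      exact eq_neg_of_add_eq_zero_left hst
    rw [curv_basis_change g (C := B) (D := B) (a := -(s⁻¹ * t)) (b := 0) (c := 1) (d := 0)
      (by simpa using hA) (by simp)]
    ring

/-- `t` is the squared determinant of the change of basis, so it is the same for all metrics. -/
theorem exists_curv_eq_of_span_eq {p : M} {A B C D : TangentSpace 𝓘(ℝ, E) p}
    (hAB : LinearIndependent ℝ ![A, B])
    (h : Submodule.span ℝ {A, B} = Submodule.span ℝ {C, D}) :
    ∃ t : ℝ, 0 < t ∧ ∀ g : SmoothMetric E M, curv g.inner p A B = t * curv g.inner p C D := by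
  have hA : A ∈ Submodule.span ℝ {C, D} := h ▸ Submodule.subset_span (by simp)
  have hB : B ∈ Submodule.span ℝ {C, D} := h ▸ Submodule.subset_span (by simp)
  obtain ⟨a, b, hA⟩ := Submodule.mem_span_pair.1 hA
  obtain ⟨c, d, hB⟩ := Submodule.mem_span_pair.1 hB
  refine ⟨(a * d - b * c) ^ 2, ?_, fun g => curv_basis_change g hA.symm hB.symm⟩
  refine sq_pos_of_ne_zero ?_
  intro h0
  rw [LinearIndependent.pair_iff] at hAB
  -- Cramer's rule: with zero determinant, `dA - bB` and `-cA + aB` vanish, which forces all four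
  -- coefficients to be zero.
  have h1 := hAB d (-b) (by
    rw [← hA, ← hB]
    have : d • (a • C + b • D) + (-b) • (c • C + d • D) = (a * d - b * c) • C := by module
    rw [this, h0, zero_smul])
  have h2 := hAB (-c) a (by
    rw [← hA, ← hB]
    have : (-c) • (a • C + b • D) + a • (c • C + d • D) = (a * d - b * c) • D := by module
    rw [this, h0, zero_smul])
  have h3 := hAB 1 0 (by rw [← hA, h2.2, neg_eq_zero.1 h1.2]; simp)
  exact one_ne_zero h3.1

/-- Positivity of the pencil through a plane with vanishing mixed curvatures. -/
theorem curv_pencil_pos (g : SmoothMetric E M) {p : M} {X W Z V : TangentSpace 𝓘(ℝ, E) p}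
    (hlin : ∀ Y, riemann g.inner p X W W Y = 0 ∧ riemann g.inner p W X X Y = 0) {ε : ℝ}
    (hpos : ∀ r : ℝ, |r| < ε → ∀ σ τ : ℝ, σ ^ 2 + τ ^ 2 = 1 →
      0 < pencilRemainder (riemann g.inner p) X W Z V σ τ r)
    {σ τ : ℝ} (hσ : σ ∈ Icc 0 (ε / 3)) (hτ : τ ∈ Icc 0 (ε / 3)) (hne : ¬ (σ = 0 ∧ τ = 0)) :
    0 < curv g.inner p (X + σ • Z) (W + τ • V) := by
  -- Polar coordinates; as `σ, τ ≤ ε / 3`, the radius satisfies `r ^ 2 ≤ 2 * ε ^ 2 / 9 < ε ^ 2`.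
  set r := Real.sqrt (σ ^ 2 + τ ^ 2) with hr
  have hsum : 0 < σ ^ 2 + τ ^ 2 := by
    rcases not_and_or.1 hne with h | h
    · have := sq_pos_of_ne_zero h; positivity
    · have := sq_pos_of_ne_zero h; positivity
  have hr0 : 0 < r := Real.sqrt_pos.2 hsum
  have hr2 : r ^ 2 = σ ^ 2 + τ ^ 2 := Real.sq_sqrt hsum.le
  have hrlt : |r| < ε := by
    rw [abs_of_pos hr0]
    nlinarith [hσ.1, hσ.2, hτ.1, hτ.2, mul_nonneg hσ.1 hτ.1]
  have h1 := hpos r hrlt (σ / r) (τ / r) (by field_simp; linarith)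
  have h2 := (isAlgCurvature_riemann g p).quadratic_pencil X W Z V (σ / r) (τ / r) r
  rw [mul_div_cancel₀ σ hr0.ne', mul_div_cancel₀ τ hr0.ne', (hlin X).1, (hlin Z).1,
    (hlin V).2] at h2
  unfold curv
  rw [h2]
  have := mul_pos (pow_pos hr0 2) h1
  linarith

end Main

end

theorem mainTheorem2
    {E : Type*} [NormedAddCommGroup E] [NormedSpace ℝ E] [FiniteDimensional ℝ E]
    {M : Type*} [TopologicalSpace M] [ChartedSpace E M] [IsManifold 𝓘(ℝ, E) ∞ M]
    [CompactSpace M] [T2Space M]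
    (g : SmoothMetric E M)
    (hnonneg : ∀ p : M, NonnegCurvedAt g.inner p)
    (𝒮 : Set (ImmersedSubmanifold E M))
    (hdim : ∀ S ∈ 𝒮, 2 ≤ S.dim)
    (hgeod : ∀ S ∈ 𝒮, S.IsTotallyGeodesic g.inner)
    (hflat : ∀ S ∈ 𝒮, S.IsFlat g.inner)
    (hzero : ∀ (p : M) (X W : TangentSpace 𝓘(ℝ, E) p), IsZeroPlane g.inner p X W →
      ∃ S ∈ 𝒮, S.ContainsPlane p X W)
    (hquad : QuadraticallyNondegenerate g.inner) :
    ∃ 𝒰 : Set (SmoothMetric E M), IsOpen[c2Topology E M] 𝒰 ∧ g ∈ 𝒰 ∧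
      ∀ g' ∈ 𝒰,
        (∀ S ∈ 𝒮, S.AgreeOn g.inner g'.inner) →
        (∀ S ∈ 𝒮, S.AgreeToFirstOrderOn g.inner g'.inner) →
        ∀ S ∈ 𝒮, ∀ y : S.carrier,
          NonnegCurvedAt g'.inner (S.toFun y) ∧
          ∀ A B : TangentSpace 𝓘(ℝ, E) (S.toFun y),
            IsZeroPlane g'.inner (S.toFun y) A B ↔ IsZeroPlane g.inner (S.toFun y) A B := by
  obtain ⟨Q, hQc, hQ, hnbhd⟩ := hquad
  let _ := c2Topology E M
  have h1 := eventually_pencilRemainder_pos g hQc (by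
    rintro q ⟨p, X, W, Z, V, hq, rfl⟩
    exact ⟨p, X, W, Z, V, rfl, (hQ p X W Z V hq).2⟩)
  rw [nhds_prod_eq] at h1
  obtain ⟨P₁, hP₁, P₂, hP₂, hP⟩ := Filter.eventually_prod_iff.1 h1
  obtain ⟨ε, hε, hP₂ε⟩ := Metric.eventually_nhds_iff.1 hP₂
  -- `U` is fixed from `ε`, which depends only on `g` and `Q`; the size `ε / 3` keeps the pencil
  -- radius below `ε`.
  obtain ⟨U, hU, hUzero, hUQ⟩ := hnbhd (ε / 3) (by positivity)
  have h2 := eventually_mem_or_curv_pos g hnonneg hU hUzero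
  obtain ⟨𝒰, h𝒰, h𝒰o, hg𝒰⟩ := eventually_nhds_iff.1 (hP₁.and h2)
  refine ⟨𝒰, h𝒰o, hg𝒰, fun g' hg' hagree hagree1 => ?_⟩
  have hlin : ∀ (p : M) (X W : TangentSpace 𝓘(ℝ, E) p), IsZeroPlane g.inner p X W → ∀ Y,
      riemann g.inner p X W W Y = 0 ∧ riemann g.inner p W X X Y = 0 := by
    intro p X W hXW
    obtain ⟨S, hS, hc⟩ := hzero p X W hXW
    exact hc.riemann_eq_zero (hgeod S hS) (hflat S hS)
  have hlin' : ∀ (p : M) (X W : TangentSpace 𝓘(ℝ, E) p), IsZeroPlane g.inner p X W → ∀ Y,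
      riemann g'.inner p X W W Y = 0 ∧ riemann g'.inner p W X X Y = 0 := by
    intro p X W hXW
    obtain ⟨S, hS, hc⟩ := hzero p X W hXW
    exact hc.riemann_eq_zero ((hgeod S hS).of_agree (hagree S hS) (hagree1 S hS))
      ((hflat S hS).of_agree (hagree S hS))
  -- Applied to `g'` and also to `g` itself, to exclude further zero planes of `g` in the pencils.
  have hpencil : ∀ (h : SmoothMetric E M), h ∈ 𝒰 → ∀ (p : M) (X W Z V : TangentSpace 𝓘(ℝ, E) p),
      (X, W, Z, V) ∈ Q p → ∀ r : ℝ, |r| < ε → ∀ σ τ : ℝ, σ ^ 2 + τ ^ 2 = 1 →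
      0 < pencilRemainder (riemann h.inner p) X W Z V σ τ r := by
    intro h hh p X W Z V hq r hr σ τ hst
    exact hP (h𝒰 h hh).1 (hP₂ε (by simpa using hr)) p X W Z V ⟨p, X, W, Z, V, hq, rfl⟩ σ τ hst
  intro S hS y
  have key : ∀ A B : TangentSpace 𝓘(ℝ, E) (S.toFun y), LinearIndependent ℝ ![A, B] →
      0 ≤ curv g'.inner (S.toFun y) A B ∧
      (curv g'.inner (S.toFun y) A B = 0 ↔ curv g.inner (S.toFun y) A B = 0) := by
    intro A B hAB
    obtain ⟨A', B', α, γ, δ, hα, hδ, hA, hB, hor⟩ := (h𝒰 g' hg').2 (S.toFun y) A B hAB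
    have hAB' := linearIndependent_pair_of_eq hα hδ hA hB hAB
    have hch : ∀ h : SmoothMetric E M, curv h.inner (S.toFun y) A B =
        (α * δ - 0 * γ) ^ 2 * curv h.inner (S.toFun y) A' B' := fun h =>
      curv_basis_change h (by simpa using hA) hB
    have hd : 0 < (α * δ - 0 * γ) ^ 2 := by
      rw [zero_mul, sub_zero]
      exact sq_pos_of_ne_zero (mul_ne_zero hα hδ)
    -- The two bases differ by the same positive factor for both metrics.
    suffices h : 0 ≤ curv g'.inner (S.toFun y) A' B' ∧
        (curv g'.inner (S.toFun y) A' B' = 0 ↔ curv g.inner (S.toFun y) A' B' = 0) by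
      rw [hch, hch]
      rw [mul_eq_zero, mul_eq_zero, or_iff_right hd.ne', or_iff_right hd.ne']
      exact ⟨mul_nonneg hd.le h.1, h.2⟩
    by_cases hmem : ((⟨S.toFun y, A'⟩, ⟨S.toFun y, B'⟩) :
        TangentBundle 𝓘(ℝ, E) M × TangentBundle 𝓘(ℝ, E) M) ∈ U
    -- The covering by pencils is available only at points that carry a zero plane; `S` provides
    -- one.
    · rcases hUQ _ A' B' (S.exists_isZeroPlane (hgeod S hS) (hflat S hS) (hdim S hS) y) hAB' hmem
        with hz | ⟨X, W, Z, V, hq, σ, hσ, τ, hτ, hspan⟩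
      · have h0 := (hlin' _ A' B' hz A').1
        exact ⟨h0.ge, ⟨fun _ => hz.2, fun _ => h0⟩⟩
      · obtain ⟨t, ht, hcurv⟩ := exists_curv_eq_of_span_eq hAB' hspan
        have hXW := (hQ _ X W Z V hq).1
        -- At the vertex of the pencil the plane is the zero plane `span {X, W}`, flat for both
        -- metrics; elsewhere both curvatures are positive.
        by_cases hne : σ = 0 ∧ τ = 0
        · rw [hcurv, hcurv, hne.1, hne.2, zero_smul, zero_smul, add_zero, add_zero, hXW.2,
            show curv g'.inner (S.toFun y) X W = 0 from (hlin' _ X W hXW X).1]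
          simp
        · have p1 := curv_pencil_pos g (hlin _ X W hXW) (hpencil g hg𝒰 _ X W Z V hq) hσ hτ hne
          have p2 := curv_pencil_pos g' (hlin' _ X W hXW) (hpencil g' hg' _ X W Z V hq) hσ hτ hne
          rw [hcurv, hcurv]
          exact ⟨(mul_pos ht p2).le, by simp [ht.ne', p1.ne', p2.ne']⟩
    · have hpos := hor.resolve_left hmem
      refine ⟨hpos.le, ⟨fun h0 => absurd h0 hpos.ne', fun h0 => absurd ?_ hmem⟩⟩
      exact hUzero _ A' B' ⟨hAB', h0⟩
  refine ⟨fun A B => ?_, fun A B => ?_⟩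
  · by_cases hAB : LinearIndependent ℝ ![A, B]
    · exact (key A B hAB).1
    · exact (curv_eq_zero_of_not_linearIndependent g' hAB).ge
  · exact and_congr_right fun hAB => (key A B hAB).2
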